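/- Let $A_3=\{0,1,2\}$ and let $A_3^*$ be the free monoid of finite words over $A_3$, with empty word $\varepsilon$. An infinite word $x$ is Sturmian if for every $n\in\mathbb{N}$ it has exactly $n+1$ distinct factors of length $n$. For $i\in A_3$ let $\pi_i$ be the map that erases all occurrences of the letter $i$. A word $x\in A_3^{\mathbb{N}}$ is a word with Sturmian erasures if for every $i\in A_3$ the word $\pi_i(x)$ is (infinite and) Sturmian. A morphism is a map $f:A_3\to A_3^*$, extended to finite and infinite words by concatenation. Let $\mathrm{MSE}$ be the monoid, under composition, of all morphisms $f$ such that $f(x)$ is a word with Sturmian erasures for every word $x$ with Sturmian erasures, and let $\mathrm{MSE}^{\varepsilon}$ be the set of all $f\in\mathrm{MSE}$ with $f(i)=\varepsilon$ for some $i\in A_3$. **Theorem.** 1. The monoid $\mathrm{MSE}$ is not finitely generated. 2. $\mathrm{MSE}$ is the union of $\mathrm{MSE}^{\varepsilon}$ and the set of (morphisms given by) permutations of $A_3$. 3. If $f:A_3\to A_3^*$ is a morphism such that $f(i)=\varepsilon$ for some $i\in A_3$, and $f(x)$ is a word with Sturmian erasures for at least one word $x$ with Sturmian erasures, then $f\in\mathrm{MSE}$.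 -/

import Mathlib

namespace SturmianErasures

/-- The block `x k, x (k+1), …, x (k+n-1)` of length `n` at position `k` of an infinite word `x`;
for `k = 0` it is the prefix of length `n`. -/
def block {α : Type*} (x : ℕ → α) (k n : ℕ) : FreeMonoid α :=
  FreeMonoid.ofList ((List.range n).map fun i => x (k + i))

/-- The complexity function: the number of distinct factors of length `n` of `x`. -/
noncomputable def complexity {α : Type*} (x : ℕ → α) (n : ℕ) : ℕ :=
  {w : FreeMonoid α | ∃ k, w = block x k n}.ncard

/-- An infinite word is Sturmian if it has exactly `n + 1` factors of length `n`, for all `n`. -/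
def IsSturmian {α : Type*} (x : ℕ → α) : Prop :=
  ∀ n, complexity x n = n + 1

/-- `f(x)` is the infinite word `y`: the images of the prefixes of `x` are prefixes of `y` of
unbounded length. (There is no such `y` exactly when `f(x)` is a finite word.) -/
def IsImage {α β : Type*} (f : FreeMonoid α →* FreeMonoid β) (x : ℕ → α) (y : ℕ → β) : Prop :=
  (∀ n, ∃ m, f (block x 0 n) = block y 0 m) ∧ ∀ N, ∃ n, N ≤ (f (block x 0 n)).length

/-- The alphabet `{0, 1, 2}`. -/
abbrev A3 : Type := Fin 3

/-- Morphisms `A3 → A3^*`, extended to endomorphisms of the free monoid `A3^*`; the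
multiplication of this monoid is composition. -/
abbrev Morphism : Type := Monoid.End (FreeMonoid A3)

/-- The morphism `π_i` that erases the letter `i` and fixes the other letters. -/
def erase (i : A3) : Morphism :=
  FreeMonoid.lift fun j => if j = i then 1 else FreeMonoid.of j

/-- Words with Sturmian erasures: for every letter `i`, the word `π_i(x)` is an (infinite)
Sturmian word. -/
def WSE : Set (ℕ → A3) :=
  {x | ∀ i : A3, ∃ y : ℕ → A3, IsImage (erase i) x y ∧ IsSturmian y}

/-- `f(x)` is a word with Sturmian erasures. -/
def MapsToWSE (f : Morphism) (x : ℕ → A3) : Prop :=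
  ∃ y ∈ WSE, IsImage f x y

@[simp] theorem length_block {α : Type*} (x : ℕ → α) (k n : ℕ) : (block x k n).length = n := by
  simp [block, FreeMonoid.length]

theorem block_add {α : Type*} (x : ℕ → α) (m n : ℕ) :
    block x 0 (m + n) = block x 0 m * block x m n := by
  simp [block, List.range_add, ← FreeMonoid.ofList_append, Function.comp_def]

/-- The image `f(x)`, when it is infinite, is unique. -/
theorem IsImage.unique {α β : Type*} {f : FreeMonoid α →* FreeMonoid β} {x : ℕ → α}
    {y z : ℕ → β} (hy : IsImage f x y) (hz : IsImage f x z) : y = z := by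
  funext j
  obtain ⟨n, hn⟩ := hy.2 (j + 1)
  obtain ⟨m, hm⟩ := hy.1 n
  obtain ⟨m', hm'⟩ := hz.1 n
  have h1 : m = m' := by
    have := congrArg FreeMonoid.length (hm.symm.trans hm')
    simpa using this
  subst h1
  rw [hm, length_block] at hn
  have h2 := congrArg (fun w => (FreeMonoid.toList w)[j]?) (hm.symm.trans hm')
  have hj : j < m := hn
  simpa [block, hj] using h2

theorem IsImage.comp {α β γ : Type*} {f : FreeMonoid β →* FreeMonoid γ}
    {g : FreeMonoid α →* FreeMonoid β} {x : ℕ → α} {y : ℕ → β} {z : ℕ → γ}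
    (hg : IsImage g x y) (hf : IsImage f y z) : IsImage (f.comp g) x z := by
  constructor
  · intro n
    obtain ⟨m, hm⟩ := hg.1 n
    obtain ⟨l, hl⟩ := hf.1 m
    exact ⟨l, by rw [MonoidHom.comp_apply, hm, hl]⟩
  · intro N
    obtain ⟨m, hm⟩ := hf.2 N
    obtain ⟨n, hn⟩ := hg.2 m
    obtain ⟨l, hl⟩ := hg.1 n
    refine ⟨n, ?_⟩
    rw [hl, length_block] at hn
    obtain ⟨d, rfl⟩ := Nat.exists_eq_add_of_le hn
    rw [MonoidHom.comp_apply, hl, block_add, map_mul, FreeMonoid.length_mul]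
    omega

theorem IsImage.id {α : Type*} (x : ℕ → α) : IsImage (MonoidHom.id (FreeMonoid α)) x x :=
  ⟨fun n => ⟨n, rfl⟩, fun N => ⟨N, by simp⟩⟩

/-- The monoid, under composition, of the morphisms with Sturmian erasures: those that map every
word with Sturmian erasures to a word with Sturmian erasures. -/
def MSE : Submonoid Morphism where
  carrier := {f | ∀ x ∈ WSE, MapsToWSE f x}
  one_mem' := fun x hx => ⟨x, hx, IsImage.id x⟩
  mul_mem' := by
    intro f g hf hg x hx
    obtain ⟨y, hy, hxy⟩ := hg x hx
    obtain ⟨z, hz, hyz⟩ := hf y hy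
    exact ⟨z, hz, hxy.comp hyz⟩

/-- The image of some letter is the empty word. -/
def ErasesLetter (f : Morphism) : Prop :=
  ∃ i : A3, f (FreeMonoid.of i) = 1

/-- The morphisms with Sturmian erasures that erase some letter. -/
def MSEε : Set Morphism :=
  {f | f ∈ MSE ∧ ErasesLetter f}

/-- The permutations of the alphabet, as morphisms. -/
def letterPermutations : Set Morphism :=
  {f | ∃ σ : Equiv.Perm A3, ∀ a, f (FreeMonoid.of a) = FreeMonoid.of (σ a)}

/-- `f` is locally with Sturmian erasures: it maps at least one word with Sturmian erasures to a
word with Sturmian erasures. -/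
def IsLocallyWSE (f : Morphism) : Prop :=
  ∃ x ∈ WSE, MapsToWSE f x

end SturmianErasures

/-!
A morphism `f` that erases the letter `i` is given by its restriction to words over the other two
letters, and the composition of this restriction with the erasure of `k` is, for each `k`, a binary
morphism. All three assertions are reduced to these binary morphisms.

The main tool is the theorem that a binary morphism which maps *one* Sturmian word to a Sturmian
word is a product of the exchange of the letters and of the insertions `b ↦ ab`, `b ↦ ba`
(`IsImage.mem_sturmianMonoid`), whence it maps *all* Sturmian words to Sturmian words
(`IsMechanical.exists_image_of_mem`); this gives the third assertion. For its proof, Sturmian words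
are identified with mechanical words (`isSturmian_iff_isMechanical`), the words whose discrepancies
from some irrational slope stay in an interval of length `1`. From a morphism that is Sturmian on
one word an insertion can be split off on the left when the images of the letters start, or end,
with a common letter that is the more frequent one. Otherwise the image of one letter starts and
ends with one letter and the image of the other with the other, and comparing the discrepancies at
which the next letter and the previous letter change shows that the morphism maps letters to letters
(`ImageInStrip.eq_one`).

A product of the elementary morphisms has determinant `±1`. For the second assertion this is used
for the composition of `f`, of an erasure and of each of three test morphisms that produce words
with Sturmian erasures (`interleave`): linear algebra shows that for each `k` some letter has a
power of `k` as its image, and unless `f` erases a letter these powers are the three letters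
(`exists_image_eq_pow`, `mem_letterPermutations_of_not_erasesLetter`).

For the first assertion, if a product of elementary morphisms is not a permutation, then one of the
images of the two letters is a prefix or a suffix of the other (`comparable_of_mem_sturmianMonoid`).
In a product of elements of `MSE` everything to the right of the first factor that erases a letter
acts through such a product. So a product in which the images of `0` and `1` are not comparable in
this way is, up to finitely many choices, one of the generators (`exists_shortMorphism`); but there
are infinitely many such morphisms (`family`).
-/

namespace SturmianErasures

open FreeMonoid (of)

/-! ### Special factors and complexity -/

/-- The number of letters `true` among the first `n` letters of a binary word. -/
def ones (x : ℕ → Bool) (n : ℕ) : ℤ :=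
  ∑ i ∈ Finset.range n, if x i then 1 else 0

/-- A binary word is mechanical if, for some irrational slope `θ`, the discrepancies
`ones x n - n θ` all lie in one closed interval of length `1`. (As `θ` is irrational, at most one of
the two ends is attained.) -/
def IsMechanical (x : ℕ → Bool) : Prop :=
  ∃ θ c : ℝ, Irrational θ ∧ ∀ n : ℕ, c ≤ ones x n - n * θ ∧ ones x n - n * θ ≤ c + 1

/-- A binary word is balanced if two of its blocks of equal length never differ by more than `1` in
their number of letters `true`. -/
def IsBalanced (x : ℕ → Bool) : Prop :=
  ∀ i j n, (ones x (i + n) - ones x i) - (ones x (j + n) - ones x j) ≤ 1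

/-- The right special factors of length `n`: the factors that can be followed by either letter. -/
def rightSpecial (x : ℕ → Bool) (n : ℕ) : Set (FreeMonoid Bool) :=
  {w | ∀ b : Bool, ∃ k, block x k n = w ∧ x (k + n) = b}

/-- From the position `N` on, the word `x` has the period `p`. -/
def EventuallyPeriodic {α : Type*} (x : ℕ → α) : Prop :=
  ∃ N p, 0 < p ∧ ∀ m, N ≤ m → x (m + p) = x m

@[simp] lemma ones_zero (x : ℕ → Bool) : ones x 0 = 0 := by simp [ones]

lemma ones_succ (x : ℕ → Bool) (n : ℕ) :
    ones x (n + 1) = ones x n + if x n then 1 else 0 := by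
  rw [ones, Finset.sum_range_succ, ones]

lemma ones_nonneg (x : ℕ → Bool) (n : ℕ) : 0 ≤ ones x n :=
  Finset.sum_nonneg fun i _ => by split <;> simp

lemma ones_le (x : ℕ → Bool) (n : ℕ) : ones x n ≤ n := by
  induction n with
  | zero => simp
  | succ n ih => rw [ones_succ]; push_cast; split <;> omega

lemma block_succ {α : Type*} (x : ℕ → α) (k n : ℕ) :
    block x k (n + 1) = block x k n * FreeMonoid.of (x (k + n)) := by
  simp [block, List.range_succ, FreeMonoid.ofList_append]

@[simp] lemma block_zero {α : Type*} (x : ℕ → α) (k : ℕ) : block x k 0 = 1 := by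
  simp [block]

lemma mul_of_inj {α : Type*} {u v : FreeMonoid α} {a b : α} :
    u * FreeMonoid.of a = v * FreeMonoid.of b ↔ u = v ∧ a = b := by
  constructor
  · intro h
    have h' := congrArg FreeMonoid.toList h
    simp only [FreeMonoid.toList_mul, FreeMonoid.toList_of] at h'
    have := List.append_inj' h' rfl
    exact ⟨FreeMonoid.toList.injective this.1, by simpa using this.2⟩
  · rintro ⟨rfl, rfl⟩; rfl

lemma block_eq_block_iff {α : Type*} {x : ℕ → α} {i j n : ℕ} :
    block x i n = block x j n ↔ ∀ t < n, x (i + t) = x (j + t) := by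
  induction n with
  | zero => simp
  | succ n ih =>
    rw [block_succ, block_succ, mul_of_inj, ih]
    exact (Nat.forall_lt_succ_right (p := fun t => x (i + t) = x (j + t))).symm

lemma finite_factors {α : Type*} [Finite α] (x : ℕ → α) (n : ℕ) :
    {w : FreeMonoid α | ∃ k, w = block x k n}.Finite := by
  refine (List.finite_length_eq α n).subset ?_
  rintro _ ⟨k, rfl⟩
  exact length_block x k n

lemma complexity_zero {α : Type*} (x : ℕ → α) : complexity x 0 = 1 := by
  simp [complexity]

lemma finite_rightSpecial (x : ℕ → Bool) (n : ℕ) : (rightSpecial x n).Finite := by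
  refine (finite_factors x n).subset fun w hw => ?_
  obtain ⟨k, hk, -⟩ := hw true
  exact ⟨k, hk.symm⟩

/-- Every factor has a right extension, and just the right special ones have two. -/
lemma complexity_succ (x : ℕ → Bool) (n : ℕ) :
    complexity x (n + 1) = complexity x n + (rightSpecial x n).ncard := by
  let A : Bool → Set (FreeMonoid Bool) := fun b => {w | ∃ k, block x k n = w ∧ x (k + n) = b}
  have hfin : ∀ b, (A b).Finite := fun b => (finite_factors x n).subset fun w => by
    rintro ⟨k, hk, -⟩; exact ⟨k, hk.symm⟩
  have hU : {w : FreeMonoid Bool | ∃ k, w = block x k n} = A true ∪ A false := by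
    ext w; constructor
    · rintro ⟨k, rfl⟩
      cases h : x (k + n)
      · exact Or.inr ⟨k, rfl, h⟩
      · exact Or.inl ⟨k, rfl, h⟩
    · rintro (⟨k, hk, -⟩ | ⟨k, hk, -⟩) <;> exact ⟨k, hk.symm⟩
  have hI : rightSpecial x n = A true ∩ A false := by
    ext w
    simp [rightSpecial, A, and_comm]
  have hS : {w : FreeMonoid Bool | ∃ k, w = block x k (n + 1)} =
      (· * FreeMonoid.of true) '' A true ∪ (· * FreeMonoid.of false) '' A false := by
    ext w; constructor
    · rintro ⟨k, rfl⟩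
      rw [block_succ]
      cases h : x (k + n)
      · exact Or.inr ⟨_, ⟨k, rfl, h⟩, rfl⟩
      · exact Or.inl ⟨_, ⟨k, rfl, h⟩, rfl⟩
    · rintro (⟨_, ⟨k, rfl, h⟩, rfl⟩ | ⟨_, ⟨k, rfl, h⟩, rfl⟩) <;>
        exact ⟨k, by rw [block_succ, h]⟩
  have hinj : ∀ b : Bool, Function.Injective (· * FreeMonoid.of b : FreeMonoid Bool → _) :=
    fun b u v h => (mul_of_inj.1 h).1
  unfold complexity
  rw [hS, Set.ncard_union_eq _ ((hfin _).image _) ((hfin _).image _),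
    Set.ncard_image_of_injective _ (hinj _), Set.ncard_image_of_injective _ (hinj _), hU, hI,
    Set.ncard_union_add_ncard_inter _ _ (hfin _) (hfin _)]
  rw [Set.disjoint_left]
  rintro _ ⟨u, -, rfl⟩ ⟨v, -, h⟩
  simpa using (mul_of_inj.1 h).2

lemma isSturmian_iff_rightSpecial (x : ℕ → Bool) :
    IsSturmian x ↔ ∀ n, (rightSpecial x n).ncard = 1 := by
  constructor
  · intro h n
    have := complexity_succ x n
    rw [h, h] at this
    omega
  · intro h n
    induction n with
    | zero => exact complexity_zero x
    | succ n ih => rw [complexity_succ, h, ih]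

lemma EventuallyPeriodic.not_isSturmian {α : Type*} {x : ℕ → α} (h : EventuallyPeriodic x) :
    ¬ IsSturmian x := by
  obtain ⟨N, p, hp, hx⟩ := h
  intro hs
  have key : ∀ n k, ∃ l < N + p, block x k n = block x l n := by
    intro n k
    induction k using Nat.strong_induction_on with
    | _ k ih =>
      by_cases hk : k < N + p
      · exact ⟨k, hk, rfl⟩
      · obtain ⟨l, hl, h⟩ := ih (k - p) (by omega)
        refine ⟨l, hl, ?_⟩
        rw [← h, block_eq_block_iff]
        intro t _
        rw [← hx (k - p + t) (by omega)]
        congr 1; omega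
  have hle : complexity x (N + p) ≤ N + p := by
    have hsub : {w : FreeMonoid α | ∃ k, w = block x k (N + p)} ⊆
        (fun l => block x l (N + p)) '' (Finset.range (N + p) : Set ℕ) := by
      rintro _ ⟨k, rfl⟩
      obtain ⟨l, hl, h⟩ := key (N + p) k
      exact ⟨l, by simpa using hl, h.symm⟩
    refine (Set.ncard_le_ncard hsub ((Finset.finite_toSet _).image _)).trans ?_
    refine (Set.ncard_image_le (Finset.finite_toSet _)).trans ?_
    simp
  rw [hs] at hle
  omega

lemma mem_rightSpecial_of {x : ℕ → Bool} {n i j : ℕ} (hb : block x i n = block x j n)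
    (h : x (i + n) ≠ x (j + n)) : block x i n ∈ rightSpecial x n := by
  intro b
  by_cases hib : x (i + n) = b
  · exact ⟨i, rfl, hib⟩
  · refine ⟨j, hb.symm, ?_⟩
    revert h hib
    cases x (i + n) <;> cases x (j + n) <;> cases b <;> simp

/-- If a block is repeated before a right special factor has occurred, the word cycles, as each
block up to the repetition determines the next letter. -/
lemma eventuallyPeriodic_of_repeat {x : ℕ → Bool} {n J p : ℕ} (hn : 0 < n) (hp : 0 < p)
    (heq : block x J n = block x (J + p) n)
    (hns : ∀ m < p, block x (J + m) n ∉ rightSpecial x n) : EventuallyPeriodic x := by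
  have key : ∀ m, block x (J + m) n ∉ rightSpecial x n ∧
      block x (J + m) n = block x (J + m + p) n := by
    intro m
    induction m using Nat.strong_induction_on with
    | _ m ih =>
      constructor
      · by_cases hm : m < p
        · exact hns m hm
        · have h := ih (m - p) (by omega)
          have e : J + (m - p) + p = J + m := by omega
          rw [e] at h
          rw [← h.2]; exact h.1
      · rcases m with _ | m
        · exact heq
        · obtain ⟨h1, h2⟩ := ih m (by omega)
          have h3 : x (J + m + n) = x (J + m + p + n) := by
            by_contra h
            exact h1 (mem_rightSpecial_of h2 h)
          rw [block_eq_block_iff] at h2 ⊢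
          intro t ht
          rcases Nat.lt_or_ge (t + 1) n with h | h
          · have := h2 (t + 1) h
            convert this using 2 <;> omega
          · have e1 : J + (m + 1) + t = J + m + n := by omega
            have e2 : J + (m + 1) + p + t = J + m + p + n := by omega
            rw [e1, e2, h3]
  refine ⟨J, p, hp, fun m hm => ?_⟩
  obtain ⟨d, rfl⟩ := Nat.exists_eq_add_of_le hm
  have := block_eq_block_iff.1 (key d).2 0 hn
  simpa using this.symm

/-! ### Mechanical words are Sturmian -/

lemma EventuallyPeriodic.not_isMechanical {x : ℕ → Bool} (h : EventuallyPeriodic x) :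
    ¬ IsMechanical x := by
  obtain ⟨N, p, hp, hx⟩ := h
  rintro ⟨θ, c, hθ, hc⟩
  have h1 : ∀ m, N ≤ m → ones x (m + p) - ones x m = ones x (N + p) - ones x N := by
    intro m hm
    induction m, hm using Nat.le_induction with
    | base => rfl
    | succ m hm ih =>
      rw [show m + 1 + p = m + p + 1 by ring, ones_succ, ones_succ, hx m hm]
      linarith
  set g : ℝ := (ones x (N + p) - ones x N : ℤ) - p * θ with hg
  have h2 : ∀ j : ℕ, (ones x (N + j * p) : ℝ) - (N + j * p : ℕ) * θ = ones x N - N * θ + j * g := by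
    intro j
    induction j with
    | zero => simp
    | succ j ih =>
      have := h1 (N + j * p) (by omega)
      have h3 : (ones x (N + j * p + p) : ℝ) =
        ones x (N + j * p) + (ones x (N + p) - ones x N : ℤ) := by
        rw [← this]; push_cast; ring
      rw [show N + (j + 1) * p = N + j * p + p by ring, h3]
      push_cast at ih ⊢
      push_cast at hg
      rw [hg] at ih ⊢
      linarith
  have hg0 : g ≠ 0 := by
    intro h0
    have h4 : (p : ℝ) * θ = (ones x (N + p) - ones x N : ℤ) := by linarith
    exact (hθ.natCast_mul hp.ne').ne_int _ h4
  obtain ⟨j, hj⟩ := exists_nat_gt (1 / |g|)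
  have hj' : 1 < j * |g| := by
    rwa [div_lt_iff₀ (abs_pos.2 hg0)] at hj
  have a1 := hc (N + j * p)
  have a2 := hc N
  rw [h2 j] at a1
  have : |(j : ℝ) * g| ≤ 1 := abs_le.2 ⟨by linarith, by linarith⟩
  rw [abs_mul, Nat.abs_cast] at this
  linarith

lemma IsMechanical.isBalanced {x : ℕ → Bool} (h : IsMechanical x) : IsBalanced x := by
  obtain ⟨θ, c, hθ, hc⟩ := h
  intro i j n
  by_contra hlt
  have hlt : 2 ≤ (ones x (i + n) - ones x i) - (ones x (j + n) - ones x j) := by omega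
  have hlt' : (2 : ℝ) ≤ (ones x (i + n) - ones x i) - (ones x (j + n) - ones x j) := by
    exact_mod_cast hlt
  have h1 := hc (i + n)
  have h2 := hc i
  have h3 := hc (j + n)
  have h4 := hc j
  push_cast at h1 h3
  have hn : n ≠ 0 := by rintro rfl; simp at hlt
  have h5 : (n : ℝ) * θ = (ones x (i + n) - ones x i - 1 : ℤ) := by
    push_cast; linarith
  exact (hθ.natCast_mul hn).ne_int _ h5

lemma ones_sub_eq_of_agree {x : ℕ → Bool} {i j n : ℕ} (h : ∀ t < n, x (i + t) = x (j + t)) :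
    ones x (i + n) - ones x i = ones x (j + n) - ones x j := by
  induction n with
  | zero => simp
  | succ n ih =>
    have := ih fun t ht => h t (by omega)
    rw [← add_assoc, ← add_assoc, ones_succ, ones_succ, h n (by omega)]
    linarith

lemma IsBalanced.rightSpecial_subsingleton {x : ℕ → Bool} (h : IsBalanced x) (n : ℕ) :
    (rightSpecial x n).Subsingleton := by
  -- Two right special factors that differ, the last time at `t`, would yield `c w c` and `d w d`.
  have key : ∀ u ∈ rightSpecial x n, ∀ v ∈ rightSpecial x n, ∀ i j, block x i n = u →
      block x j n = v → ∀ t < n, (∀ s, t < s → s < n → x (i + s) = x (j + s)) →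
      x (i + t) = true → x (j + t) = true := by
    intro u hu v hv i j hi hj t ht hts hit
    by_contra hjt
    obtain ⟨i', hi', hi1⟩ := hu true
    obtain ⟨j', hj', hj1⟩ := hv false
    have ei := block_eq_block_iff.1 (hi'.trans hi.symm)
    have ej := block_eq_block_iff.1 (hj'.trans hj.symm)
    have e := ones_sub_eq_of_agree (x := x) (i := i' + (t + 1)) (j := j' + (t + 1))
      (n := n - (t + 1)) (fun s hs => by
        rw [add_assoc i', add_assoc j', ei _ (by omega), ej _ (by omega)]
        exact hts _ (by omega) (by omega))
    have b := h (i' + t) (j' + t) (n - t + 1)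
    rw [show i' + t + (n - t + 1) = i' + n + 1 by omega,
      show j' + t + (n - t + 1) = j' + n + 1 by omega, ones_succ, ones_succ, hi1, hj1] at b
    rw [show i' + (t + 1) + (n - (t + 1)) = i' + n by omega,
      show j' + (t + 1) + (n - (t + 1)) = j' + n by omega, ← add_assoc, ← add_assoc,
      ones_succ, ones_succ, ei t ht, ej t ht, hit] at e
    simp only [hjt] at e
    simp at e b
    omega
  intro u hu v hv
  obtain ⟨i, hi, -⟩ := hu true
  obtain ⟨j, hj, -⟩ := hv true
  rw [← hi, ← hj, block_eq_block_iff]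
  have main : ∀ d ≤ n, ∀ t, n - d ≤ t → t < n → x (i + t) = x (j + t) := by
    intro d
    induction d with
    | zero => intro _ t h1 h2; omega
    | succ d ih =>
      intro hd t h1 h2
      rcases Nat.lt_or_ge t (n - d) with h3 | h3
      · have hag : ∀ s, t < s → s < n → x (i + s) = x (j + s) :=
          fun s hs hs' => ih (by omega) s (by omega) hs'
        have k1 := key u hu v hv i j hi hj t h2 hag
        have k2 := key v hv u hu j i hj hi t h2 fun s hs hs' => (hag s hs hs').symm
        cases hx : x (i + t) <;> cases hy : x (j + t) <;> simp_all
      · exact ih (by omega) t h3 h2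
  exact fun t ht => main n le_rfl t (by omega) ht

/-- Without right special factors every block determines the next letter, and one of the finitely
many blocks is repeated. -/
lemma rightSpecial_nonempty {x : ℕ → Bool} (h : ¬ EventuallyPeriodic x) (n : ℕ) :
    (rightSpecial x n).Nonempty := by
  by_contra hne
  rw [Set.not_nonempty_iff_eq_empty] at hne
  -- The length is raised by one because cycling needs blocks that are not empty.
  have hne' : rightSpecial x (n + 1) = ∅ := by
    rw [Set.eq_empty_iff_forall_notMem] at hne ⊢
    intro w hw
    obtain ⟨i, hi, hi'⟩ := hw true
    obtain ⟨j, hj, hj'⟩ := hw false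
    have e := block_eq_block_iff.1 (hi.trans hj.symm)
    refine hne _ (mem_rightSpecial_of (i := i + 1) (j := j + 1) ?_ ?_)
    · rw [block_eq_block_iff]
      intro t ht
      have := e (t + 1) (by omega)
      convert this using 2 <;> omega
    · rw [show i + 1 + n = i + (n + 1) by ring, show j + 1 + n = j + (n + 1) by ring, hi', hj']
      simp
  have hmaps : Set.MapsTo (fun k => block x k (n + 1)) Set.univ
      {w : FreeMonoid Bool | ∃ k, w = block x k (n + 1)} := fun k _ => ⟨k, rfl⟩
  obtain ⟨i, -, j, -, hij, e⟩ :=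
    Set.infinite_univ.exists_lt_map_eq_of_mapsTo hmaps (finite_factors x _)
  obtain ⟨p, rfl⟩ := Nat.exists_eq_add_of_lt hij
  refine h (eventuallyPeriodic_of_repeat (n := n + 1) (J := i) (p := p + 1) (by omega) (by omega)
    e fun m _ => ?_)
  rw [hne']; exact id

lemma IsMechanical.isSturmian {x : ℕ → Bool} (h : IsMechanical x) : IsSturmian x := by
  rw [isSturmian_iff_rightSpecial]
  intro n
  obtain ⟨w, hw⟩ := rightSpecial_nonempty (fun hp => hp.not_isMechanical h) n
  rw [Set.ncard_eq_one]
  exact ⟨w, (h.isBalanced.rightSpecial_subsingleton n).eq_singleton_of_mem hw⟩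

/-! ### Sturmian words are mechanical -/

/-- A shortest pair of unbalanced blocks has the form `true w true`, `false w false` with `w` a
palindrome. -/
lemma exists_palindrome_of_not_isBalanced {x : ℕ → Bool} (h : ¬ IsBalanced x) :
    ∃ i j n, 0 < n ∧ x i = true ∧ x (i + n) = true ∧ x j = false ∧ x (j + n) = false ∧
      ∀ t, 0 < t → t < n → x (i + t) = x (j + t) ∧ x (i + t) = x (i + (n - t)) := by
  classical
  have hex : ∃ n, ∃ i j, 2 ≤ (ones x (i + n) - ones x i) - (ones x (j + n) - ones x j) := by
    unfold IsBalanced at h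
    push Not at h
    obtain ⟨i, j, n, hn⟩ := h
    exact ⟨n, i, j, by omega⟩
  obtain ⟨i, j, hij⟩ := Nat.find_spec hex
  set N := Nat.find hex
  have hmin : ∀ t < N, ∀ i j, (ones x (i + t) - ones x i) - (ones x (j + t) - ones x j) ≤ 1 := by
    intro t ht i j
    by_contra hlt
    exact Nat.find_min hex ht ⟨i, j, by omega⟩
  have hN0 : N ≠ 0 := by
    intro h0; rw [h0] at hij; simp at hij
  have hN1 : N ≠ 1 := by
    intro h1; rw [h1, ones_succ, ones_succ] at hij
    split_ifs at hij <;> omega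
  have pre : ∀ t, 0 < t → t < N →
      (ones x (i + t) - ones x i) - (ones x (j + t) - ones x j) = 1 := by
    intro t h0 ht
    have a := hmin t ht i j
    have b := hmin (N - t) (by omega) (i + t) (j + t)
    rw [show i + t + (N - t) = i + N by omega, show j + t + (N - t) = j + N by omega] at b
    omega
  have tot : (ones x (i + N) - ones x i) - (ones x (j + N) - ones x j) = 2 := by
    have a := pre 1 (by omega) (by omega)
    have b := hmin (N - 1) (by omega) (i + 1) (j + 1)
    rw [show i + 1 + (N - 1) = i + N by omega, show j + 1 + (N - 1) = j + N by omega] at b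
    omega
  -- Prefixes of one block against suffixes of the other show the palindromic symmetry.
  have pal : ∀ t, 0 < t → t < N →
      ones x (i + t) - ones x i = ones x (i + N) - ones x (i + (N - t)) := by
    intro t h0 ht
    have a := pre t h0 ht
    have b := pre (N - t) (by omega) (by omega)
    have c := hmin t ht i (j + (N - t))
    have d := hmin t ht (i + (N - t)) j
    rw [show j + (N - t) + t = j + N by omega] at c
    rw [show i + (N - t) + t = i + N by omega] at d
    omega
  have step : ∀ k, ones x (k + 1) = ones x k + if x k then 1 else 0 := ones_succ x
  have first : x i = true ∧ x j = false := by
    have a := pre 1 (by omega) (by omega)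
    rw [step, step] at a
    cases hi : x i <;> cases hj : x j <;> simp_all
  have last : x (i + (N - 1)) = true ∧ x (j + (N - 1)) = false := by
    have a := pre (N - 1) (by omega) (by omega)
    have e1 := step (i + (N - 1))
    have e2 := step (j + (N - 1))
    rw [show i + (N - 1) + 1 = i + N by omega] at e1
    rw [show j + (N - 1) + 1 = j + N by omega] at e2
    cases hi : x (i + (N - 1)) <;> cases hj : x (j + (N - 1)) <;>
      simp only [hi, hj] at e1 e2 ⊢ <;> simp at e1 e2 <;> first | omega | simp
  refine ⟨i, j, N - 1, by omega, first.1, last.1, first.2, last.2, fun t h0 ht => ⟨?_, ?_⟩⟩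
  · have a := pre t h0 (by omega)
    have b := pre (t + 1) (by omega) (by omega)
    rw [← add_assoc, ← add_assoc, step, step] at b
    cases hi : x (i + t) <;> cases hj : x (j + t) <;> simp only [hi, hj] at b ⊢ <;> simp at b <;>
      omega
  · have a := pal t h0 (by omega)
    have b := pal (t + 1) (by omega) (by omega)
    have e := step (i + (N - (t + 1)))
    rw [show i + (N - (t + 1)) + 1 = i + (N - t) by omega] at e
    rw [← add_assoc, step] at b
    rw [show i + (N - 1 - t) = i + (N - (t + 1)) by omega]
    cases hi : x (i + t) <;> cases hj : x (i + (N - (t + 1))) <;> simp only [hi, hj] at b e ⊢ <;>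
      simp at b e <;> omega

/-- If `c w c` and `d w d` are factors with `w` a palindrome and `c ≠ d`, and `c w` is the only
right special factor of its length, then no factor `d w d v` with `v` as long as `w` contains `c w`,
so that all blocks inside it have forced continuations; as there are too few of them, one is
repeated. -/
lemma eventuallyPeriodic_of_palindrome {x : ℕ → Bool} (hx : IsSturmian x) {i j n : ℕ} (hn : 0 < n)
    (hi : x i ≠ x j) (hin : x (j + n) ≠ x i)
    (hw : ∀ t, 0 < t → t < n → x (i + t) = x (j + t) ∧ x (i + t) = x (i + (n - t)))
    (hs : rightSpecial x n = {block x i n}) : EventuallyPeriodic x := by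
  have hns : ∀ s ≤ n, block x (j + s) n ∉ rightSpecial x n := by
    intro s hsn hmem
    rw [hs, Set.mem_singleton_iff, block_eq_block_iff] at hmem
    rcases Nat.eq_zero_or_pos s with rfl | h0
    · exact hi (hmem 0 hn).symm
    rcases Nat.lt_or_ge s n with h1 | h1
    · have a := hmem 0 hn
      have b := hmem (n - s) (by omega)
      rw [show j + s + (n - s) = j + n by omega, ← (hw s h0 h1).2, (hw s h0 h1).1] at b
      simp only [add_zero] at a
      exact hin (b.trans a)
    · have := hmem 0 hn
      rw [show j + s + 0 = j + n by omega] at this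
      exact hin this
  have hcard : ({w : FreeMonoid Bool | ∃ k, w = block x k n} \ rightSpecial x n).ncard = n := by
    have hsub : rightSpecial x n ⊆ {w : FreeMonoid Bool | ∃ k, w = block x k n} := by
      rw [hs]; rintro _ rfl; exact ⟨i, rfl⟩
    rw [Set.ncard_sdiff hsub (finite_rightSpecial x n), hs, Set.ncard_singleton]
    have := hx n
    unfold complexity at this
    rw [this]; rfl
  have hfin := (finite_factors x n).subset (Set.sdiff_subset (t := rightSpecial x n))
  have hmaps : ∀ s ∈ Finset.range (n + 1), block x (j + s) n ∈ hfin.toFinset := by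
    intro s hs
    rw [Set.Finite.mem_toFinset]
    exact ⟨⟨_, rfl⟩, hns s (by simpa [Nat.lt_succ_iff] using hs)⟩
  obtain ⟨s, hs1, s', hs2, hne, he⟩ := Finset.exists_ne_map_eq_of_card_lt_of_maps_to
    (by rw [← Set.ncard_eq_toFinset_card _ hfin, hcard]; simp) hmaps
  simp only [Finset.mem_range] at hs1 hs2
  rcases Nat.lt_or_gt_of_ne hne with h | h
  · refine eventuallyPeriodic_of_repeat (J := j + s) (p := s' - s) hn (by omega) ?_ ?_
    · rw [show j + s + (s' - s) = j + s' by omega]; exact he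
    · intro m hm
      rw [add_assoc]; exact hns _ (by omega)
  · refine eventuallyPeriodic_of_repeat (J := j + s') (p := s - s') hn (by omega) ?_ ?_
    · rw [show j + s' + (s - s') = j + s by omega]; exact he.symm
    · intro m hm
      rw [add_assoc]; exact hns _ (by omega)

/-- A Sturmian word that is not balanced would be eventually periodic. -/
lemma IsSturmian.isBalanced {x : ℕ → Bool} (hx : IsSturmian x) : IsBalanced x := by
  by_contra hb
  obtain ⟨i, j, n, hn, hi, hin, hj, hjn, hw⟩ := exists_palindrome_of_not_isBalanced hb
  have hrs := (isSturmian_iff_rightSpecial x).1 hx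
  obtain ⟨u, hu⟩ := Set.ncard_eq_one.1 (hrs n)
  obtain ⟨w, hw'⟩ := Set.ncard_eq_one.1 (hrs (n - 1))
  -- The right special factor of length `n` extends `w` to the left: it is `c w` for a letter `c`.
  have hwi : block x (i + 1) (n - 1) = w := by
    have : block x (i + 1) (n - 1) ∈ rightSpecial x (n - 1) := by
      refine mem_rightSpecial_of (j := j + 1) ?_ ?_
      · rw [block_eq_block_iff]
        intro t ht
        have := (hw (t + 1) (by omega) (by omega)).1
        convert this using 2 <;> omega
      · rw [show i + 1 + (n - 1) = i + n by omega, show j + 1 + (n - 1) = j + n by omega, hin, hjn]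
        simp
    rw [hw'] at this; exact this
  have hu1 : u ∈ rightSpecial x n := by rw [hu]; rfl
  obtain ⟨k, hk, hk'⟩ := hu1 true
  obtain ⟨l, hl, hl'⟩ := hu1 false
  have hwk : block x (k + 1) (n - 1) = w := by
    have : block x (k + 1) (n - 1) ∈ rightSpecial x (n - 1) := by
      refine mem_rightSpecial_of (j := l + 1) ?_ ?_
      · rw [block_eq_block_iff]
        intro t ht
        have := block_eq_block_iff.1 (hk.trans hl.symm) (t + 1) (by omega)
        convert this using 2 <;> omega
      · rw [show k + 1 + (n - 1) = k + n by omega, show l + 1 + (n - 1) = l + n by omega, hk', hl']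
        simp
    rw [hw'] at this; exact this
  have hag : ∀ t, 0 < t → t < n → x (k + t) = x (i + t) := by
    intro t h0 ht
    have := block_eq_block_iff.1 (hwk.trans hwi.symm) (t - 1) (by omega)
    convert this using 2 <;> omega
  refine EventuallyPeriodic.not_isSturmian (x := x) ?_ hx
  cases hxk : x k
  · refine eventuallyPeriodic_of_palindrome hx (i := j) (j := i) hn (by simp [hi, hj])
      (by simp [hin, hj]) (fun t h0 ht => ⟨(hw t h0 ht).1.symm, ?_⟩) ?_
    · rw [← (hw t h0 ht).1, ← (hw (n - t) (by omega) (by omega)).1]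
      exact (hw t h0 ht).2
    · rw [hu, ← hk, Set.singleton_eq_singleton_iff, block_eq_block_iff]
      intro t ht
      rcases Nat.eq_zero_or_pos t with rfl | h0
      · simp [hxk, hj]
      · rw [hag t h0 ht, (hw t h0 ht).1]
  · refine eventuallyPeriodic_of_palindrome hx (i := i) (j := j) hn (by simp [hi, hj])
      (by simp [hi, hjn]) hw ?_
    rw [hu, ← hk, Set.singleton_eq_singleton_iff, block_eq_block_iff]
    intro t ht
    rcases Nat.eq_zero_or_pos t with rfl | h0
    · simp [hxk, hi]
    · exact hag t h0 ht

lemma IsBalanced.ones_mul_le {x : ℕ → Bool} (h : IsBalanced x) (j m n : ℕ) :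
    ones x (n * m) ≤ n * (ones x (j + m) - ones x j + 1) := by
  induction n with
  | zero => simp
  | succ n ih =>
    have := h (n * m) j m
    rw [add_mul, one_mul]; push_cast
    linarith

lemma IsBalanced.le_ones_mul {x : ℕ → Bool} (h : IsBalanced x) (j m n : ℕ) :
    n * (ones x (j + m) - ones x j - 1) ≤ ones x (n * m) := by
  induction n with
  | zero => simp
  | succ n ih =>
    have := h j (n * m) m
    rw [add_mul, one_mul]; push_cast
    linarith

/-- Splitting a block of length `m n` into blocks of length `m` or of length `n` compares the
densities of blocks of different lengths, and the slope is the cut between their lower and upper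
bounds. -/
lemma IsBalanced.exists_slope {x : ℕ → Bool} (h : IsBalanced x) :
    ∃ θ : ℝ, ∀ i n, |((ones x (i + n) - ones x i : ℤ) : ℝ) - n * θ| ≤ 1 := by
  let U : Set ℝ := {r | ∃ i n : ℕ, 0 < n ∧ r = ((ones x (i + n) - ones x i - 1 : ℤ) : ℝ) / n}
  have hUV : ∀ r ∈ U, ∀ j m : ℕ, 0 < m → r ≤ ((ones x (j + m) - ones x j + 1 : ℤ) : ℝ) / m := by
    rintro _ ⟨i, n, hn, rfl⟩ j m hm
    have a := h.le_ones_mul i n m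
    have b := h.ones_mul_le j m n
    rw [mul_comm m n] at a
    have hn' : (0 : ℝ) < n := by exact_mod_cast hn
    have hm' : (0 : ℝ) < m := by exact_mod_cast hm
    rw [div_le_div_iff₀ hn' hm']
    have := a.trans b
    have : ((m : ℤ) * (ones x (i + n) - ones x i - 1 : ℤ) : ℝ) ≤
        (n : ℤ) * (ones x (j + m) - ones x j + 1 : ℤ) := by
      exact_mod_cast this
    push_cast at this ⊢
    linarith
  have hne : U.Nonempty := ⟨_, 0, 1, one_pos, rfl⟩
  refine ⟨sSup U, fun i n => ?_⟩
  rcases Nat.eq_zero_or_pos n with rfl | hn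
  · simp
  have hn' : (0 : ℝ) < n := by exact_mod_cast hn
  have h1 : ((ones x (i + n) - ones x i - 1 : ℤ) : ℝ) / n ≤ sSup U :=
    le_csSup ⟨_, fun r hr => hUV r hr 0 1 one_pos⟩ ⟨i, n, hn, rfl⟩
  have h2 : sSup U ≤ ((ones x (i + n) - ones x i + 1 : ℤ) : ℝ) / n :=
    csSup_le hne fun r hr => hUV r hr i n hn
  rw [div_le_iff₀ hn'] at h1
  rw [le_div_iff₀ hn'] at h2
  push_cast at h1 h2 ⊢
  rw [abs_le]; constructor <;> linarith

/-- A balanced word of rational slope `a / q` is eventually periodic: the numbers of letters `true`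
in its blocks of length `q` deviate from `a` all in the same direction, and at most `q` times. -/
lemma IsBalanced.eventuallyPeriodic {x : ℕ → Bool} (h : IsBalanced x) {θ : ℝ}
    (hθ : ∀ i n, |((ones x (i + n) - ones x i : ℤ) : ℝ) - n * θ| ≤ 1) (hr : ¬ Irrational θ) :
    EventuallyPeriodic x := by
  obtain ⟨r, rfl⟩ : ∃ r : ℚ, (r : ℝ) = θ := by
    rw [Irrational, not_not] at hr; exact hr
  set q := r.den
  have hq : 0 < q := r.den_pos
  have hqr : (q : ℝ) * r = r.num := by
    have := Rat.den_mul_eq_num r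
    exact_mod_cast this
  let g : ℕ → ℤ := fun m => ones x (m + q) - ones x m - r.num
  have hbal : ∀ i j, g i - g j ≤ 1 := fun i j => by
    have := h i j q
    simp only [g]; linarith
  have hsum : ∀ m J : ℕ, |∑ k ∈ Finset.range J, g (m + k * q)| ≤ 1 := by
    intro m J
    have e : ∑ k ∈ Finset.range J, g (m + k * q) = ones x (m + J * q) - ones x m - J * r.num := by
      induction J with
      | zero => simp
      | succ J ih =>
        rw [Finset.sum_range_succ, ih, show m + (J + 1) * q = m + J * q + q by ring]
        simp only [g]; push_cast; ring
    have := hθ m (J * q)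
    rw [e]
    push_cast at this
    rw [mul_assoc, hqr] at this
    exact_mod_cast this
  have hsign : (∀ m, 0 ≤ g m) ∨ (∀ m, g m ≤ 0) := by
    by_contra hcon
    push Not at hcon
    obtain ⟨⟨i, hi⟩, j, hj⟩ := hcon
    have := hbal j i
    omega
  have hunique : ∀ m J, 0 < J → g m ≠ 0 → g (m + J * q) = 0 := by
    intro m J hJ h0
    by_contra h1
    have a := hsum m (J + 1)
    have hs0 : 0 ∈ Finset.range (J + 1) := by simp
    have hsJ : J ∈ (Finset.range (J + 1)).erase 0 := by simp; omega
    rw [← Finset.add_sum_erase _ _ hs0, ← Finset.add_sum_erase _ _ hsJ] at a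
    simp only [zero_mul, add_zero] at a
    rcases hsign with hs | hs
    · have c := Finset.sum_nonneg (s := ((Finset.range (J + 1)).erase 0).erase J)
        (f := fun k => g (m + k * q)) fun k _ => hs _
      have := hs m; have := hs (m + J * q)
      rw [abs_le] at a
      omega
    · have c := Finset.sum_nonpos (s := ((Finset.range (J + 1)).erase 0).erase J)
        (f := fun k => g (m + k * q)) fun k _ => hs _
      have := hs m; have := hs (m + J * q)
      rw [abs_le] at a
      omega
  have hfin : {m | g m ≠ 0}.Finite := by
    refine Set.Finite.of_injOn (f := fun m => m % q) (t := Set.Iio q)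
      (fun m _ => Nat.mod_lt _ hq) ?_ (Set.finite_Iio q)
    have aux : ∀ a b, g a ≠ 0 → g b ≠ 0 → a % q = b % q → a ≤ b → a = b := by
      intro a b ha hb hab hle
      by_contra hne
      obtain ⟨J, hJ⟩ := (Nat.modEq_iff_dvd' hle).1 hab
      have hJ0 : 0 < J := by
        rcases Nat.eq_zero_or_pos J with rfl | h
        · simp at hJ; omega
        · exact h
      refine hb ?_
      have := hunique a J hJ0 ha
      rwa [show a + J * q = b by rw [mul_comm J, ← hJ]; omega] at this
    intro a ha b hb hab
    rcases le_total a b with hl | hl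
    · exact aux a b ha hb hab hl
    · exact (aux b a hb ha hab.symm hl).symm
  obtain ⟨N, hN⟩ := hfin.bddAbove
  refine ⟨N + 1, q, hq, fun m hm => ?_⟩
  have z : ∀ m, N + 1 ≤ m → g m = 0 := by
    intro m hm
    by_contra h0
    have := hN h0
    omega
  have a := z m hm
  have b := z (m + 1) (by omega)
  simp only [g] at a b
  rw [show m + 1 + q = m + q + 1 by ring, ones_succ, ones_succ] at b
  cases h1 : x (m + q) <;> cases h2 : x m <;> simp only [h1, h2] at b <;> simp at b ⊢ <;> omega

theorem isSturmian_iff_isMechanical (x : ℕ → Bool) : IsSturmian x ↔ IsMechanical x := by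
  refine ⟨fun hx => ?_, IsMechanical.isSturmian⟩
  obtain ⟨θ, hθ⟩ := hx.isBalanced.exists_slope
  have hirr : Irrational θ := by
    by_contra hr
    exact (hx.isBalanced.eventuallyPeriodic hθ hr).not_isSturmian hx
  let R : Set ℝ := Set.range fun n : ℕ => (ones x n : ℝ) - n * θ
  have hdiff : ∀ m n : ℕ, (ones x n : ℝ) - n * θ ≤ ones x m - m * θ + 1 := by
    intro m n
    rcases le_total m n with hl | hl
    all_goals
      obtain ⟨d, rfl⟩ := Nat.exists_eq_add_of_le hl
    · have := (abs_le.1 (hθ m d)).2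
      push_cast at this ⊢
      linarith
    · have := (abs_le.1 (hθ n d)).1
      push_cast at this ⊢
      linarith
  refine ⟨θ, sInf R, hirr, fun n => ⟨csInf_le ?_ ⟨n, rfl⟩, ?_⟩⟩
  · refine ⟨(ones x 0 : ℝ) - (0 : ℕ) * θ - 1, ?_⟩
    rintro _ ⟨m, rfl⟩
    have := hdiff m 0
    simp only at this ⊢
    linarith
  · have : (ones x n : ℝ) - n * θ - 1 ≤ sInf R := by
      refine le_csInf (Set.range_nonempty _) ?_
      rintro _ ⟨m, rfl⟩
      have := hdiff m n
      simp only
      linarith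
    linarith

/-! ### Discrepancies -/

/-- The discrepancy of a finite binary word from the slope `θ`. -/
def disc (θ : ℝ) (w : FreeMonoid Bool) : ℝ :=
  (FreeMonoid.toList w).count true - w.length * θ

@[simp] lemma disc_one (θ : ℝ) : disc θ 1 = 0 := by simp [disc]

@[simp] lemma disc_mul (θ : ℝ) (u v : FreeMonoid Bool) : disc θ (u * v) = disc θ u + disc θ v := by
  simp only [disc, FreeMonoid.toList_mul, List.count_append, FreeMonoid.length_mul]
  push_cast; ring

@[simp] lemma disc_of_true (θ : ℝ) : disc θ (FreeMonoid.of true) = 1 - θ := by simp [disc]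

@[simp] lemma disc_of_false (θ : ℝ) : disc θ (FreeMonoid.of false) = -θ := by simp [disc]

lemma disc_block (θ : ℝ) (x : ℕ → Bool) (n : ℕ) : disc θ (block x 0 n) = ones x n - n * θ := by
  induction n with
  | zero => simp
  | succ n ih =>
    rw [block_succ, disc_mul, ih, ones_succ]
    cases h : x (0 + n) <;> rw [zero_add] at h <;> simp [h] <;> ring

/-- As the slope is irrational, the discrepancy of a word determines its length. -/
lemma length_eq_of_disc_eq {θ : ℝ} (hθ : Irrational θ) {w : FreeMonoid Bool} {a : ℤ} {b : ℕ}
    (h : disc θ w = a - b * θ) : w.length = b := by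
  by_contra hne
  have hne' : ((w.length : ℤ) - b) ≠ 0 := by
    rw [sub_ne_zero]; exact_mod_cast hne
  have : ((w.length : ℤ) - b : ℤ) * θ = ((FreeMonoid.toList w).count true - a : ℤ) := by
    unfold disc at h
    push_cast
    linarith
  exact (hθ.intCast_mul hne').ne_int _ this

/-- All discrepancies of prefixes of `x` from the slope `θ` lie in `[c, c + 1]`. -/
def InStrip (x : ℕ → Bool) (θ c : ℝ) : Prop :=
  ∀ n, c ≤ disc θ (block x 0 n) ∧ disc θ (block x 0 n) ≤ c + 1

/-- All discrepancies of prefixes of `h(x)` from the slope `θ` lie in `[c, c + 1]`. -/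
def ImageInStrip (h : Monoid.End (FreeMonoid Bool)) (x : ℕ → Bool) (θ c : ℝ) : Prop :=
  ∀ n p q, h (block x 0 n) = p * q → c ≤ disc θ p ∧ disc θ p ≤ c + 1

lemma isMechanical_iff_inStrip (x : ℕ → Bool) :
    IsMechanical x ↔ ∃ θ c : ℝ, Irrational θ ∧ InStrip x θ c := by
  simp only [IsMechanical, InStrip, disc_block]

lemma InStrip.slope_mem {x : ℕ → Bool} {θ c : ℝ} (h : InStrip x θ c) (hθ : Irrational θ) :
    0 < θ ∧ θ < 1 := by
  have hb : ∀ n : ℕ, |(ones x n : ℝ) - n * θ| ≤ 1 := by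
    intro n
    have h0 := h 0
    have hn := h n
    rw [disc_block] at h0 hn
    simp only [ones_zero, Int.cast_zero, Nat.cast_zero, zero_mul, sub_zero] at h0
    rw [abs_le]; constructor <;> linarith
  constructor
  · by_contra hle
    have hlt : 0 < -θ := by
      rcases (not_lt.1 hle).lt_or_eq with h | h
      · linarith
      · exact absurd h hθ.ne_zero
    obtain ⟨n, hn⟩ := exists_nat_gt (1 / -θ)
    rw [div_lt_iff₀ hlt] at hn
    have := (abs_le.1 (hb n)).2
    have h1 : (0 : ℝ) ≤ ones x n := by exact_mod_cast ones_nonneg x n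
    linarith
  · by_contra hle
    have hlt : 0 < θ - 1 := by
      rcases (not_lt.1 hle).lt_or_eq with h | h
      · linarith
      · exact absurd h.symm hθ.ne_one
    obtain ⟨n, hn⟩ := exists_nat_gt (1 / (θ - 1))
    rw [div_lt_iff₀ hlt] at hn
    have := (abs_le.1 (hb n)).1
    have h1 : (ones x n : ℝ) ≤ n := by exact_mod_cast ones_le x n
    linarith

/-- The discrepancies of a mechanical word come arbitrarily close to both ends of their strip. By
Dirichlet, some shift `q` changes them by a tiny `δ` modulo `1`; as they stay bounded, the change is
sometimes `δ ± 1`. -/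
lemma InStrip.exists_near_ends {x : ℕ → Bool} {θ c : ℝ} (h : InStrip x θ c) (hθ : Irrational θ)
    {ε : ℝ} (hε : 0 < ε) :
    (∃ n, c + 1 - ε ≤ disc θ (block x 0 (n + 1))) ∧ ∃ n, disc θ (block x 0 (n + 1)) ≤ c + ε := by
  obtain ⟨k, hk⟩ := exists_nat_one_div_lt hε
  obtain ⟨p, q, hq, -, hpq⟩ := Real.exists_int_int_abs_mul_sub_le θ (n := k + 1) (by omega)
  lift q to ℕ using hq.le
  have hq' : 0 < q := by exact_mod_cast hq
  set δ : ℝ := p - q * θ with hδ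
  have hδ0 : δ ≠ 0 := by
    intro h0
    exact (hθ.natCast_mul hq'.ne').ne_int p (by linarith)
  have hδε : |δ| < ε := by
    have e : |δ| = |(q : ℤ) * θ - p| := by rw [hδ, ← abs_neg]; congr 1; push_cast; ring
    rw [e]
    refine hpq.trans_lt (lt_of_le_of_lt ?_ hk)
    push_cast
    exact one_div_le_one_div_of_le (by positivity) (by linarith)
  have hjump : ∃ n, 1 ≤ n ∧ ones x (n + q) - ones x n ≠ p := by
    by_contra hcon
    push Not at hcon
    have hlin : ∀ j : ℕ, disc θ (block x 0 (1 + j * q)) = disc θ (block x 0 1) + j * δ := by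
      intro j
      induction j with
      | zero => simp
      | succ j ih =>
        have e := hcon (1 + j * q) (by omega)
        rw [disc_block] at ih ⊢
        have e' : (ones x (1 + j * q + q) : ℝ) = ones x (1 + j * q) + p := by
          rw [← e]; push_cast; ring
        rw [show 1 + (j + 1) * q = 1 + j * q + q by ring, e']
        push_cast at ih ⊢
        rw [hδ] at ih ⊢
        linarith
    obtain ⟨j, hj⟩ := exists_nat_gt (1 / |δ|)
    rw [div_lt_iff₀ (abs_pos.2 hδ0)] at hj
    have a1 := h (1 + j * q)
    have a2 := h 1
    rw [hlin] at a1
    have : |(j : ℝ) * δ| ≤ 1 := abs_le.2 ⟨by linarith, by linarith⟩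
    rw [abs_mul, Nat.abs_cast] at this
    linarith
  obtain ⟨n, hn, hne⟩ := hjump
  obtain ⟨m, rfl⟩ := Nat.exists_eq_add_of_le' hn
  have a1 := h (m + 1)
  have a2 := h (m + 1 + q)
  have e : disc θ (block x 0 (m + 1 + q)) - disc θ (block x 0 (m + 1)) =
      ((ones x (m + 1 + q) - ones x (m + 1) - p : ℤ) : ℝ) + δ := by
    rw [disc_block, disc_block, hδ]; push_cast; ring
  have hδ' := abs_lt.1 hδε
  rcases lt_or_gt_of_ne hne with hlt | hgt
  · have : ((ones x (m + 1 + q) - ones x (m + 1) - p : ℤ) : ℝ) ≤ -1 := by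
      exact_mod_cast (by omega : ones x (m + 1 + q) - ones x (m + 1) - p ≤ -1)
    refine ⟨⟨m, by linarith⟩, ⟨m + q, ?_⟩⟩
    rw [show m + q + 1 = m + 1 + q by ring]; linarith
  · have : (1 : ℝ) ≤ ((ones x (m + 1 + q) - ones x (m + 1) - p : ℤ) : ℝ) := by
      exact_mod_cast (by omega : 1 ≤ ones x (m + 1 + q) - ones x (m + 1) - p)
    refine ⟨⟨m + q, ?_⟩, ⟨m, by linarith⟩⟩
    rw [show m + q + 1 = m + 1 + q by ring]; linarith

lemma disc_block_succ (θ : ℝ) (x : ℕ → Bool) (n : ℕ) :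
    disc θ (block x 0 (n + 1)) = disc θ (block x 0 n) + if x n then 1 - θ else -θ := by
  rw [block_succ, disc_mul, zero_add]
  cases x n <;> simp

/-- Near the top of the strip a letter `true` has just been read and a letter `false` follows. -/
lemma InStrip.letters_near_top {x : ℕ → Bool} {θ c : ℝ} (h : InStrip x θ c) {n : ℕ}
    (h1 : c + 1 - θ < disc θ (block x 0 (n + 1))) (h2 : c + θ < disc θ (block x 0 (n + 1))) :
    x n = true ∧ x (n + 1) = false := by
  have a := (h n).2
  have b := (h (n + 2)).2
  have e1 := disc_block_succ θ x n
  have e2 := disc_block_succ θ x (n + 1)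
  constructor
  · cases hx : x n
    · rw [hx] at e1; simp at e1; linarith
    · rfl
  · cases hx : x (n + 1)
    · rfl
    · rw [hx] at e2; simp at e2; linarith

lemma InStrip.letters_near_bottom {x : ℕ → Bool} {θ c : ℝ} (h : InStrip x θ c) {n : ℕ}
    (h1 : disc θ (block x 0 (n + 1)) < c + 1 - θ) (h2 : disc θ (block x 0 (n + 1)) < c + θ) :
    x n = false ∧ x (n + 1) = true := by
  have a := (h n).1
  have b := (h (n + 2)).1
  have e1 := disc_block_succ θ x n
  have e2 := disc_block_succ θ x (n + 1)
  constructor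
  · cases hx : x n
    · rfl
    · rw [hx] at e1; simp at e1; linarith
  · cases hx : x (n + 1)
    · rw [hx] at e2; simp at e2; linarith
    · rfl

lemma InStrip.exists_factor {x : ℕ → Bool} {θ c : ℝ} (h : InStrip x θ c) (hθ : Irrational θ)
    (b : Bool) : ∃ n, x n = b ∧ x (n + 1) = !b := by
  obtain ⟨h0, h1⟩ := h.slope_mem hθ
  have hε : 0 < min θ (1 - θ) / 2 := by
    have : 0 < min θ (1 - θ) := lt_min h0 (by linarith)
    linarith
  have m1 := min_le_left θ (1 - θ)
  have m2 := min_le_right θ (1 - θ)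
  obtain ⟨⟨n, hn⟩, ⟨m, hm⟩⟩ := h.exists_near_ends hθ hε
  cases b
  · exact ⟨m, h.letters_near_bottom (by linarith) (by linarith)⟩
  · exact ⟨n, h.letters_near_top (by linarith) (by linarith)⟩

/-! ### Infinite images -/

section Images

variable {α β γ : Type*}

lemma mul_inj_of_length_eq {u v p q : FreeMonoid α} (h : u * v = p * q)
    (hl : u.length = p.length) : u = p ∧ v = q := by
  have h' := congrArg FreeMonoid.toList h
  simp only [FreeMonoid.toList_mul] at h'
  have := List.append_inj h' hl
  exact ⟨FreeMonoid.toList.injective this.1, FreeMonoid.toList.injective this.2⟩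

lemma eq_block_of_mul_eq {x : ℕ → α} {n : ℕ} {p q : FreeMonoid α} (h : block x 0 n = p * q) :
    p = block x 0 p.length := by
  have hl := congrArg FreeMonoid.length h
  rw [length_block, FreeMonoid.length_mul] at hl
  rw [hl, block_add] at h
  exact (mul_inj_of_length_eq h (by simp)).1.symm

lemma block_le {x : ℕ → α} {m n : ℕ} (h : m ≤ n) : ∃ q, block x 0 n = block x 0 m * q := by
  obtain ⟨d, rfl⟩ := Nat.exists_eq_add_of_le h
  exact ⟨_, block_add x m d⟩

/-- An image whose prefixes are of unbounded length is an infinite word. -/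
lemma exists_isImage (f : FreeMonoid α →* FreeMonoid β) (x : ℕ → α)
    (h : ∀ N, ∃ n, N ≤ (f (block x 0 n)).length) : ∃ y, IsImage f x y := by
  choose k hk using fun j => h (j + 1)
  have hk' : ∀ j, j < (FreeMonoid.toList (f (block x 0 (k j)))).length := hk
  refine ⟨fun j => (FreeMonoid.toList (f (block x 0 (k j))))[j]'(hk' j), fun n => ?_, h⟩
  refine ⟨(f (block x 0 n)).length, FreeMonoid.toList.injective ?_⟩
  have hpre : ∀ m n j : ℕ, m ≤ n → j < (FreeMonoid.toList (f (block x 0 m))).length →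
      (FreeMonoid.toList (f (block x 0 m)))[j]? = (FreeMonoid.toList (f (block x 0 n)))[j]? := by
    intro m n j hmn hj
    obtain ⟨q, hq⟩ := block_le (x := x) hmn
    rw [hq, map_mul, FreeMonoid.toList_mul, List.getElem?_append_left hj]
  refine List.ext_getElem (by simp [block, FreeMonoid.length]) fun j h1 h2 => ?_
  have : (FreeMonoid.toList (f (block x 0 n)))[j]? =
      (FreeMonoid.toList (f (block x 0 (k j))))[j]? := by
    rcases le_total n (k j) with hle | hle
    · exact hpre _ _ _ hle h1
    · exact (hpre _ _ _ hle (hk' j)).symm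
  rw [List.getElem?_eq_getElem h1, List.getElem?_eq_getElem (hk' j)] at this
  simp only [Option.some.injEq] at this
  rw [this]
  simp [block]

/-- If `f (g (x))` is infinite, it is the image of `g (x)` under `f`. -/
lemma IsImage.of_comp {f : FreeMonoid β →* FreeMonoid γ} {g : FreeMonoid α →* FreeMonoid β}
    {x : ℕ → α} {y : ℕ → β} {z : ℕ → γ} (hg : IsImage g x y) (h : IsImage (f.comp g) x z) :
    IsImage f y z := by
  constructor
  · intro n
    obtain ⟨k, hk⟩ := hg.2 n
    obtain ⟨m, hm⟩ := hg.1 k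
    rw [hm, length_block] at hk
    obtain ⟨q, hq⟩ := block_le (x := y) hk
    obtain ⟨l, hl⟩ := h.1 k
    rw [MonoidHom.comp_apply, hm, hq, map_mul] at hl
    exact ⟨_, eq_block_of_mul_eq hl.symm⟩
  · intro N
    obtain ⟨n, hn⟩ := h.2 N
    obtain ⟨m, hm⟩ := hg.1 n
    rw [MonoidHom.comp_apply, hm] at hn
    exact ⟨m, hn⟩

lemma IsImage.exists_block_prefix {f : FreeMonoid α →* FreeMonoid β} {x : ℕ → α} {y : ℕ → β}
    (h : IsImage f x y) (m : ℕ) : ∃ n q, f (block x 0 n) = block y 0 m * q := by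
  obtain ⟨n, hn⟩ := h.2 m
  obtain ⟨l, hl⟩ := h.1 n
  rw [hl, length_block] at hn
  obtain ⟨q, hq⟩ := block_le (x := y) hn
  exact ⟨n, q, by rw [hl, hq]⟩

lemma length_block_image_ge {f : FreeMonoid α →* FreeMonoid β}
    (hf : ∀ a, f (FreeMonoid.of a) ≠ 1) (x : ℕ → α) (n : ℕ) :
    n ≤ (f (block x 0 n)).length := by
  induction n with
  | zero => simp
  | succ n ih =>
    rw [block_succ, map_mul, FreeMonoid.length_mul]
    have : (f (FreeMonoid.of (x (0 + n)))).length ≠ 0 := by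
      rw [Ne, FreeMonoid.length_eq_zero]; exact hf _
    omega

lemma exists_isImage_of_nonerasing {f : FreeMonoid α →* FreeMonoid β}
    (hf : ∀ a, f (FreeMonoid.of a) ≠ 1) (x : ℕ → α) : ∃ y, IsImage f x y :=
  exists_isImage f x fun N => ⟨N, length_block_image_ge hf x N⟩

end Images

lemma IsImage.imageInStrip {h : Monoid.End (FreeMonoid Bool)} {x y : ℕ → Bool} {θ c : ℝ}
    (hy : IsImage h x y) (hs : InStrip y θ c) : ImageInStrip h x θ c := by
  intro n p q hpq
  obtain ⟨m, hm⟩ := hy.1 n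
  rw [eq_block_of_mul_eq (hm.symm.trans hpq)]
  exact hs _

lemma IsImage.inStrip {h : Monoid.End (FreeMonoid Bool)} {x y : ℕ → Bool} {θ c : ℝ}
    (hy : IsImage h x y) (hs : ImageInStrip h x θ c) : InStrip y θ c := by
  intro m
  obtain ⟨n, q, hq⟩ := hy.exists_block_prefix m
  exact hs _ _ _ hq

/-! ### The monoid of binary Sturmian morphisms -/

/-- The binary morphism with `false ↦ u` and `true ↦ v`. -/
def binaryMorphism (u v : FreeMonoid Bool) : Monoid.End (FreeMonoid Bool) :=
  FreeMonoid.lift fun b => if b then v else u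

@[simp] lemma binaryMorphism_false (u v : FreeMonoid Bool) :
    binaryMorphism u v (of false) = u :=
  FreeMonoid.lift_eval_of _ _

@[simp] lemma binaryMorphism_true (u v : FreeMonoid Bool) :
    binaryMorphism u v (of true) = v :=
  FreeMonoid.lift_eval_of _ _

/-- The exchange of the two letters. -/
def exchange : Monoid.End (FreeMonoid Bool) := binaryMorphism (of true) (of false)

/-- The morphism that inserts a letter `false` to the left of every letter `true`. -/
def insertLeft : Monoid.End (FreeMonoid Bool) :=
  binaryMorphism (of false) (of false * of true)

/-- The morphism that inserts a letter `false` to the right of every letter `true`. -/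
def insertRight : Monoid.End (FreeMonoid Bool) :=
  binaryMorphism (of false) (of true * of false)

/-- The monoid of binary morphisms generated by `exchange`, `insertLeft` and `insertRight`. -/
def sturmianMonoid : Submonoid (Monoid.End (FreeMonoid Bool)) :=
  Submonoid.closure {exchange, insertLeft, insertRight}

lemma exchange_mem : exchange ∈ sturmianMonoid := Submonoid.subset_closure (by simp)
lemma insertLeft_mem : insertLeft ∈ sturmianMonoid := Submonoid.subset_closure (by simp)
lemma insertRight_mem : insertRight ∈ sturmianMonoid := Submonoid.subset_closure (by simp)

@[simp] lemma exchange_of (b : Bool) : exchange (of b) = of (!b) := by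
  cases b <;> simp [exchange]
@[simp] lemma insertLeft_false : insertLeft (of false) = of false := by simp [insertLeft]
@[simp] lemma insertLeft_true : insertLeft (of true) = of false * of true := by simp [insertLeft]
@[simp] lemma insertRight_false : insertRight (of false) = of false := by simp [insertRight]
@[simp] lemma insertRight_true : insertRight (of true) = of true * of false := by
  simp [insertRight]

lemma end_mul_apply {M : Type*} [Monoid M] (f g : Monoid.End M) (w : M) : (f * g) w = f (g w) := rfl

lemma end_ext {g h : Monoid.End (FreeMonoid Bool)} (h0 : g (of false) = h (of false))
    (h1 : g (of true) = h (of true)) : g = h := by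
  refine FreeMonoid.hom_eq fun b => ?_
  cases b
  · exact h0
  · exact h1

lemma exchange_mul_exchange : exchange * exchange = 1 := by
  apply end_ext <;> simp

lemma exists_first {α : Type*} {w : FreeMonoid α} (h : w ≠ 1) : ∃ a u, w = of a * u := by
  induction w using FreeMonoid.casesOn with
  | one => exact absurd rfl h
  | of_mul a u => exact ⟨a, u, rfl⟩

lemma exists_last {α : Type*} {w : FreeMonoid α} (h : w ≠ 1) : ∃ a u, w = u * of a := by
  have h' : FreeMonoid.toList w ≠ [] := fun h0 => h (FreeMonoid.toList.injective h0)
  refine ⟨(FreeMonoid.toList w).getLast h', FreeMonoid.ofList (FreeMonoid.toList w).dropLast, ?_⟩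
  apply FreeMonoid.toList.injective
  simp [List.dropLast_append_getLast h']

/-- The discrepancy of `h(w)` from `θ'` as an affine function of the discrepancy of `w` from `θ` and
its length. -/
lemma disc_hom (h : Monoid.End (FreeMonoid Bool)) (θ θ' : ℝ) (w : FreeMonoid Bool) :
    disc θ' (h w) = (disc θ' (h (of true)) - disc θ' (h (of false))) * disc θ w +
      w.length * ((1 - θ) * disc θ' (h (of false)) + θ * disc θ' (h (of true))) := by
  induction w using FreeMonoid.inductionOn' with
  | one => simp
  | of_mul b w ih =>
    rw [map_mul, disc_mul, ih, disc_mul, FreeMonoid.length_mul]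
    cases b <;> simp <;> ring

/-! ### Morphisms that map one mechanical word to a mechanical word -/

section Local

variable {h : Monoid.End (FreeMonoid Bool)} {x : ℕ → Bool} {θ c θ' c' : ℝ}

/-- The frequencies of the letters of `x` cancel the discrepancies of their images, as otherwise the
discrepancies of `h(x)` would be unbounded. -/
lemma ImageInStrip.disc_balance (hi : ImageInStrip h x θ' c') (hx : InStrip x θ c) :
    (1 - θ) * disc θ' (h (of false)) + θ * disc θ' (h (of true)) = 0 := by
  by_contra hs
  set s := (1 - θ) * disc θ' (h (of false)) + θ * disc θ' (h (of true))
  set K := disc θ' (h (of true)) - disc θ' (h (of false))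
  obtain ⟨n, hn⟩ := exists_nat_gt ((1 + |K|) / |s|)
  rw [div_lt_iff₀ (abs_pos.2 hs)] at hn
  have e := disc_hom h θ θ' (block x 0 n)
  rw [length_block] at e
  change _ = K * _ + n * s at e
  have h0 := hx 0
  have h1 := hx n
  have h2 := hi 0 1 1 (by simp)
  have h3 := hi n _ 1 (mul_one _).symm
  simp only [block_zero, disc_one] at h0 h2
  have a : |disc θ (block x 0 n)| ≤ 1 := abs_le.2 ⟨by linarith, by linarith⟩
  have b : |disc θ' (h (block x 0 n))| ≤ 1 := abs_le.2 ⟨by linarith, by linarith⟩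
  have d : |(n : ℝ) * s| ≤ 1 + |K| := by
    rw [show (n : ℝ) * s = disc θ' (h (block x 0 n)) - K * disc θ (block x 0 n) by linarith]
    refine (abs_sub _ _).trans ?_
    rw [abs_mul]
    have := mul_le_mul_of_nonneg_left a (abs_nonneg K)
    linarith
  rw [abs_mul, Nat.abs_cast] at d
  linarith

lemma eq_one_of_disc_eq_zero (hθ' : Irrational θ') {w : FreeMonoid Bool} (hw : disc θ' w = 0) :
    w = 1 := by
  have := length_eq_of_disc_eq hθ' (w := w) (a := 0) (b := 0) (by simpa using hw)
  exact FreeMonoid.length_eq_zero.1 this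

lemma ImageInStrip.nonerasing (hi : ImageInStrip h x θ' c') (hx : InStrip x θ c)
    (hθ : Irrational θ) (hθ' : Irrational θ') (hne : ∃ b, h (of b) ≠ 1) (b : Bool) :
    h (of b) ≠ 1 := by
  have e := hi.disc_balance hx
  obtain ⟨b', hb'⟩ := hne
  intro h1
  have hθ1 : (1 - θ) ≠ 0 := fun h => hθ.ne_one (by linarith)
  apply hb'
  apply eq_one_of_disc_eq_zero hθ'
  cases b <;> cases b' <;> simp [h1, hθ.ne_zero, hθ1] at e ⊢ <;> exact e

lemma ImageInStrip.slope_mem (hi : ImageInStrip h x θ' c') (hθ' : Irrational θ')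
    (hne : ∀ b, h (of b) ≠ 1) : 0 < θ' ∧ θ' < 1 := by
  obtain ⟨y, hy⟩ := exists_isImage_of_nonerasing hne x
  exact (hy.inStrip hi).slope_mem hθ'

lemma ImageInStrip.of_eq (hi : ImageInStrip h x θ' c') {n : ℕ} {p w q : FreeMonoid Bool}
    (e : h (block x 0 n) = p * w * q) :
    c' ≤ disc θ' p ∧ disc θ' p + disc θ' w ≤ c' + 1 ∧
      c' ≤ disc θ' p + disc θ' w ∧ disc θ' p ≤ c' + 1 := by
  have h1 := hi n p (w * q) (by rw [e, mul_assoc])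
  have h2 := hi n (p * w) q e
  rw [disc_mul] at h2
  exact ⟨h1.1, h2.2, h2.1, h1.2⟩

/-- For a slope less than `1 / 2` two letters `true` are never adjacent. -/
lemma ImageInStrip.not_true_true (hi : ImageInStrip h x θ' c') (hlt : θ' < 1 / 2) {n : ℕ}
    {p q : FreeMonoid Bool} : h (block x 0 n) ≠ p * (of true * of true) * q := by
  intro e
  have := hi.of_eq e
  simp at this
  linarith

lemma ImageInStrip.letter_not_true_true (hi : ImageInStrip h x θ' c') (hx : InStrip x θ c)
    (hθ : Irrational θ) (hlt : θ' < 1 / 2) (b : Bool) (p q : FreeMonoid Bool) :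
    h (of b) ≠ p * (of true * of true) * q := by
  intro e
  obtain ⟨n, hn, -⟩ := hx.exists_factor hθ b
  refine hi.not_true_true hlt (n := n + 1) (p := h (block x 0 n) * p) (q := q) ?_
  rw [block_succ, map_mul, zero_add, hn, e]
  simp only [mul_assoc]

lemma ImageInStrip.pair_not_true_true (hi : ImageInStrip h x θ' c') (hx : InStrip x θ c)
    (hθ : Irrational θ) (hlt : θ' < 1 / 2) (b : Bool) {p q : FreeMonoid Bool}
    (e1 : h (of b) = p * of true) : h (of !b) ≠ of true * q := by
  intro e2
  obtain ⟨n, hn, hn'⟩ := hx.exists_factor hθ b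
  refine hi.not_true_true hlt (n := n + 2) (p := h (block x 0 n) * p) (q := q) ?_
  rw [block_succ, block_succ, map_mul, map_mul, zero_add, zero_add, hn, hn', e1, e2]
  simp only [mul_assoc]

end Local

lemma exists_insertLeft_eq_aux : ∀ l : List Bool, (∀ p q, l ≠ p ++ true :: true :: q) →
    (∀ q, l ≠ true :: q) → ∃ w, FreeMonoid.toList (insertLeft w) = l
  | [], _, _ => ⟨1, by simp⟩
  | true :: l, _, h => absurd rfl (h l)
  | [false], _, _ => ⟨of false, by simp⟩
  | false :: false :: l, h, _ => by
    obtain ⟨w, hw⟩ := exists_insertLeft_eq_aux (false :: l)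
      (fun p q e => h (false :: p) q (by rw [e]; rfl)) (by simp)
    exact ⟨of false * w, by rw [map_mul, FreeMonoid.toList_mul, hw]; simp⟩
  | false :: true :: l, h, _ => by
    obtain ⟨w, hw⟩ := exists_insertLeft_eq_aux l
      (fun p q e => h (false :: true :: p) q (by rw [e]; rfl))
      (fun q e => h [false] q (by rw [e]; rfl))
    exact ⟨of true * w, by rw [map_mul, FreeMonoid.toList_mul, hw]; simp⟩

lemma exists_insertRight_eq_aux : ∀ l : List Bool, (∀ p q, l ≠ p ++ true :: true :: q) →
    (∀ p, l ≠ p ++ [true]) → ∃ w, FreeMonoid.toList (insertRight w) = l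
  | [], _, _ => ⟨1, by simp⟩
  | [true], _, h => absurd rfl (h [])
  | true :: true :: l, h, _ => absurd rfl (h [] l)
  | false :: l, h, h' => by
    obtain ⟨w, hw⟩ := exists_insertRight_eq_aux l
      (fun p q e => h (false :: p) q (by rw [e]; rfl)) (fun p e => h' (false :: p) (by rw [e]; rfl))
    exact ⟨of false * w, by rw [map_mul, FreeMonoid.toList_mul, hw]; simp⟩
  | true :: false :: l, h, h' => by
    obtain ⟨w, hw⟩ := exists_insertRight_eq_aux l
      (fun p q e => h (true :: false :: p) q (by rw [e]; rfl))
      (fun p e => h' (true :: false :: p) (by rw [e]; rfl))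
    exact ⟨of true * w, by rw [map_mul, FreeMonoid.toList_mul, hw]; simp⟩

lemma exists_insertLeft_eq {w : FreeMonoid Bool} (h : ∀ p q, w ≠ p * (of true * of true) * q)
    (h' : ∀ q, w ≠ of true * q) : ∃ w', insertLeft w' = w :=
  (exists_insertLeft_eq_aux (FreeMonoid.toList w)
    (fun p q e => h (FreeMonoid.ofList p) (FreeMonoid.ofList q) (by
      apply FreeMonoid.toList.injective; simp [e]))
    (fun q e => h' (FreeMonoid.ofList q) (by apply FreeMonoid.toList.injective; simp [e]))).imp
    fun _ e => FreeMonoid.toList.injective e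

lemma exists_insertRight_eq {w : FreeMonoid Bool} (h : ∀ p q, w ≠ p * (of true * of true) * q)
    (h' : ∀ p, w ≠ p * of true) : ∃ w', insertRight w' = w :=
  (exists_insertRight_eq_aux (FreeMonoid.toList w)
    (fun p q e => h (FreeMonoid.ofList p) (FreeMonoid.ofList q) (by
      apply FreeMonoid.toList.injective; simp [e]))
    (fun q e => h' (FreeMonoid.ofList q) (by apply FreeMonoid.toList.injective; simp [e]))).imp
    fun _ e => FreeMonoid.toList.injective e

lemma insertLeft_eq_of_mul (w : FreeMonoid Bool) (hw : w ≠ 1) :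
    ∃ u, insertLeft w = of false * u := by
  obtain ⟨b, u, rfl⟩ := exists_first hw
  cases b
  · exact ⟨insertLeft u, by simp⟩
  · exact ⟨of true * insertLeft u, by simp [mul_assoc]⟩

lemma insertRight_eq_mul_of (w : FreeMonoid Bool) (hw : w ≠ 1) :
    ∃ u, insertRight w = u * of false := by
  obtain ⟨b, u, rfl⟩ := exists_last hw
  cases b
  · exact ⟨insertRight u, by simp⟩
  · exact ⟨insertRight u * of true, by simp [mul_assoc]⟩

/-- Inserting letters changes a slope `θ` into `θ / (1 + θ)`. -/
lemma disc_insertLeft {θ' : ℝ} (hθ' : θ' ≠ 1) (w : FreeMonoid Bool) :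
    disc θ' (insertLeft w) = (1 - θ') * disc (θ' / (1 - θ')) w := by
  have h1 : 1 - θ' ≠ 0 := fun h => hθ' (by linarith)
  induction w using FreeMonoid.inductionOn' with
  | one => simp
  | of_mul b w ih =>
    rw [map_mul, disc_mul, ih, disc_mul]
    cases b
    · simp; field_simp
    · simp; field_simp; ring

lemma disc_insertRight {θ' : ℝ} (hθ' : θ' ≠ 1) (w : FreeMonoid Bool) :
    disc θ' (insertRight w) = (1 - θ') * disc (θ' / (1 - θ')) w := by
  have h1 : 1 - θ' ≠ 0 := fun h => hθ' (by linarith)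
  induction w using FreeMonoid.inductionOn' with
  | one => simp
  | of_mul b w ih =>
    rw [map_mul, disc_mul, ih, disc_mul]
    cases b
    · simp; field_simp
    · simp; field_simp; ring

lemma disc_exchange (θ : ℝ) (w : FreeMonoid Bool) :
    disc θ (exchange w) = - disc (1 - θ) w := by
  induction w using FreeMonoid.inductionOn' with
  | one => simp
  | of_mul b w ih =>
    rw [map_mul, disc_mul, ih, disc_mul]
    cases b <;> simp <;> ring

lemma irrational_div_one_sub {θ : ℝ} (h : Irrational θ) : Irrational (θ / (1 - θ)) := by
  have h1 : 1 - θ ≠ 0 := fun h' => h.ne_one (by linarith)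
  have : Irrational ((1 - θ)⁻¹) := by
    have := h.natCast_sub 1
    rw [Nat.cast_one] at this
    exact this.inv
  have h2 := this.sub_natCast 1
  convert h2 using 1
  push_cast
  field_simp
  ring

lemma length_insertLeft (w : FreeMonoid Bool) :
    (insertLeft w).length = w.length + (FreeMonoid.toList w).count true := by
  induction w using FreeMonoid.inductionOn' with
  | one => simp
  | of_mul b w ih =>
    rw [map_mul, FreeMonoid.length_mul, ih, FreeMonoid.length_mul, FreeMonoid.toList_mul]
    cases b <;> simp <;> ring

lemma length_insertRight (w : FreeMonoid Bool) :
    (insertRight w).length = w.length + (FreeMonoid.toList w).count true := by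
  induction w using FreeMonoid.inductionOn' with
  | one => simp
  | of_mul b w ih =>
    rw [map_mul, FreeMonoid.length_mul, ih, FreeMonoid.length_mul, FreeMonoid.toList_mul]
    cases b <;> simp <;> ring

/-! ### Morphisms that are Sturmian on one word are generated by the elementary ones -/

lemma block_succ_left {α : Type*} (x : ℕ → α) (n : ℕ) :
    block x 0 (n + 1) = of (x 0) * block (fun k => x (k + 1)) 0 n := by
  rw [add_comm, block_add]
  congr 1
  simp [block, add_comm]

lemma exchange_block (x : ℕ → Bool) (n : ℕ) :
    exchange (block x 0 n) = block (fun k => !x k) 0 n := by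
  induction n with
  | zero => simp
  | succ n ih => rw [block_succ, block_succ, map_mul, ih, exchange_of]

lemma exchange_exchange (w : FreeMonoid Bool) : exchange (exchange w) = w := by
  rw [← end_mul_apply, exchange_mul_exchange]; rfl

section Peeling

variable {h g : Monoid.End (FreeMonoid Bool)} {x : ℕ → Bool} {θ c θ' c' : ℝ}

lemma InStrip.tail (hx : InStrip x θ c) :
    InStrip (fun k => x (k + 1)) θ (c - disc θ (of (x 0))) := by
  intro n
  have := hx (n + 1)
  rw [block_succ_left, disc_mul] at this
  constructor <;> linarith

lemma InStrip.flip (hx : InStrip x θ c) : InStrip (fun k => !x k) (1 - θ) (-c - 1) := by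
  intro n
  have := hx n
  rw [← exchange_block, disc_exchange, sub_sub_cancel]
  constructor <;> linarith

lemma ImageInStrip.exchange_mul (hi : ImageInStrip h x θ' c') :
    ImageInStrip (exchange * h) x (1 - θ') (-c' - 1) := by
  intro n p q e
  have e' : h (block x 0 n) = exchange p * exchange q := by
    rw [← map_mul, ← e, end_mul_apply, exchange_exchange]
  have := hi n _ _ e'
  rw [disc_exchange] at this
  constructor <;> linarith

lemma ImageInStrip.mul_exchange (hi : ImageInStrip h x θ' c') :
    ImageInStrip (h * exchange) (fun k => !x k) θ' c' := by
  intro n p q e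
  rw [← exchange_block, end_mul_apply, exchange_exchange] at e
  exact hi n p q e

lemma ImageInStrip.of_insertLeft_mul (hi : ImageInStrip (insertLeft * g) x θ' c')
    (h1 : θ' < 1) (hg : ∀ b, g (of b) ≠ 1) :
    ImageInStrip g x (θ' / (1 - θ')) ((c' + θ') / (1 - θ')) := by
  intro n p q e
  have h1' : 0 < 1 - θ' := by linarith
  -- A letter `false` follows every prefix that is an image, which keeps it off the bottom of the
  -- strip.
  obtain ⟨u, hu⟩ := insertLeft_eq_of_mul (q * g (of (x n))) (by
    obtain ⟨a, v, hv⟩ := exists_last (hg (x n))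
    rw [hv, ← mul_assoc]
    intro h0
    simpa using congrArg FreeMonoid.length h0)
  have e' : (insertLeft * g) (block x 0 (n + 1)) = insertLeft p * of false * u := by
    rw [end_mul_apply, block_succ, map_mul, zero_add, e, mul_assoc, map_mul, hu, mul_assoc]
  have := hi.of_eq e'
  rw [disc_insertLeft h1.ne, disc_of_false] at this
  rw [div_le_iff₀ h1', ← sub_le_iff_le_add, le_div_iff₀ h1']
  constructor <;> linarith

/-- The word is replaced by its tail: the image of the first letter precedes all prefixes of the
image of the tail, so that a letter `false` precedes every prefix that is an image, which keeps it
off the top of the strip. -/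
lemma ImageInStrip.of_insertRight_mul (hi : ImageInStrip (insertRight * g) x θ' c')
    (h1 : θ' < 1) (hg : ∀ b, g (of b) ≠ 1) :
    ImageInStrip g (fun k => x (k + 1)) (θ' / (1 - θ'))
      ((c' - disc θ' (insertRight (g (of (x 0))))) / (1 - θ')) := by
  intro n p q e
  have h1' : 0 < 1 - θ' := by linarith
  obtain ⟨u, hu⟩ := insertRight_eq_mul_of (g (of (x 0)) * p) (by
    obtain ⟨a, v, hv⟩ := exists_first (hg (x 0))
    rw [hv, mul_assoc]
    intro h0
    simpa using congrArg FreeMonoid.length h0)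
  have e' : (insertRight * g) (block x 0 (n + 1)) = u * of false * insertRight q := by
    rw [end_mul_apply, block_succ_left, map_mul, e, ← mul_assoc, map_mul, hu]
  have := hi.of_eq e'
  have hd := congrArg (disc θ') hu
  rw [map_mul, disc_mul, disc_mul, disc_of_false, disc_insertRight h1.ne p] at hd
  rw [disc_of_false] at this
  rw [div_le_iff₀ h1', ← sub_le_iff_le_add, le_div_iff₀ h1']
  constructor <;> linarith

lemma ImageInStrip.exists_true (hi : ImageInStrip h x θ' c') (hx : InStrip x θ c)
    (hθ : Irrational θ) (hθ' : Irrational θ') (hne : ∀ b, h (of b) ≠ 1) :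
    0 < (FreeMonoid.toList (h (of false))).count true +
      (FreeMonoid.toList (h (of true))).count true := by
  by_contra h0
  have h0 : (FreeMonoid.toList (h (of false))).count true = 0 ∧
      (FreeMonoid.toList (h (of true))).count true = 0 := by omega
  have e := hi.disc_balance hx
  obtain ⟨a1, a2⟩ := hi.slope_mem hθ' hne
  obtain ⟨b1, b2⟩ := hx.slope_mem hθ
  have hl : ∀ b, (0 : ℝ) < (h (of b)).length := fun b => by
    rw [Nat.cast_pos, Nat.pos_iff_ne_zero, Ne, FreeMonoid.length_eq_zero]
    exact hne b
  simp only [disc, h0.1, h0.2] at e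
  have p1 := mul_pos (sub_pos.2 b2) (mul_pos (hl false) a1)
  have p2 := mul_pos b1 (mul_pos (hl true) a1)
  simp at e
  linarith

/-- If the images of both letters start and end with those letters, both thresholds that decide the
next and the previous letter of `x` are mapped to the corresponding thresholds of `h(x)`. The
difference of the thresholds is the discrepancy of a block of two different letters, so the images
of the two letters have total length `2`. -/
lemma ImageInStrip.eq_one (hi : ImageInStrip h x θ' c') (hx : InStrip x θ c)
    (hθ : Irrational θ) (hθ' : Irrational θ') {u u' v v' : FreeMonoid Bool}
    (hu : h (of false) = of false * u) (hu' : h (of false) = u' * of false)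
    (hv : h (of true) = of true * v) (hv' : h (of true) = v' * of true) : h = 1 := by
  obtain ⟨t0, t1⟩ := hx.slope_mem hθ
  have bal := hi.disc_balance hx
  set K := disc θ' (h (of true)) - disc θ' (h (of false)) with hK
  have hd : ∀ n, disc θ' (h (block x 0 n)) = K * disc θ (block x 0 n) := fun n => by
    rw [disc_hom h θ, bal, mul_zero, add_zero]
  have next_true : ∀ n, x n = true → K * disc θ (block x 0 n) ≤ c' + θ' := by
    intro n hn
    have := hi.of_eq (n := n + 1) (p := h (block x 0 n)) (w := of true) (q := v)
      (by rw [block_succ, map_mul, zero_add, hn, hv, mul_assoc])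
    rw [hd, disc_of_true] at this
    linarith
  have next_false : ∀ n, x n = false → c' + θ' ≤ K * disc θ (block x 0 n) := by
    intro n hn
    have := hi.of_eq (n := n + 1) (p := h (block x 0 n)) (w := of false) (q := u)
      (by rw [block_succ, map_mul, zero_add, hn, hu, mul_assoc])
    rw [hd, disc_of_false] at this
    linarith
  have prev_true : ∀ n, x n = true → c' + 1 - θ' ≤ K * disc θ (block x 0 (n + 1)) := by
    intro n hn
    have e : h (block x 0 (n + 1)) = h (block x 0 n) * v' * of true := by
      rw [block_succ, map_mul, zero_add, hn, hv', mul_assoc]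
    have := hi.of_eq (n := n + 1) (p := h (block x 0 n) * v') (w := of true) (q := 1)
      (by rw [mul_one, e])
    rw [← hd, e, disc_mul, disc_of_true]
    rw [disc_of_true] at this
    linarith
  have prev_false : ∀ n, x n = false → K * disc θ (block x 0 (n + 1)) ≤ c' + 1 - θ' := by
    intro n hn
    have e : h (block x 0 (n + 1)) = h (block x 0 n) * u' * of false := by
      rw [block_succ, map_mul, zero_add, hn, hu', mul_assoc]
    have := hi.of_eq (n := n + 1) (p := h (block x 0 n) * u') (w := of false) (q := 1)
      (by rw [mul_one, e])
    rw [← hd, e, disc_mul, disc_of_false]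
    rw [disc_of_false] at this
    linarith
  have key : ∀ ε : ℝ, 0 < ε → |1 - 2 * θ' - K * (1 - 2 * θ)| ≤ ε := by
    intro ε hε
    set η := min (min θ (1 - θ) / 2) (ε / (2 * (|K| + 1)))
    have hη : 0 < η := by
      refine lt_min ?_ (by positivity)
      have : 0 < min θ (1 - θ) := lt_min t0 (by linarith)
      linarith
    have m1 : η ≤ min θ (1 - θ) / 2 := min_le_left _ _
    have m2 := min_le_left θ (1 - θ)
    have m3 := min_le_right θ (1 - θ)
    have m4 : 2 * η * |K| ≤ ε := by
      have : η ≤ ε / (2 * (|K| + 1)) := min_le_right _ _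
      rw [le_div_iff₀ (by positivity)] at this
      linarith
    obtain ⟨⟨n, hn⟩, ⟨m, hm⟩⟩ := hx.exists_near_ends hθ hη
    obtain ⟨n1, n2⟩ := hx.letters_near_top (n := n) (by linarith) (by linarith)
    obtain ⟨k1, k2⟩ := hx.letters_near_bottom (n := m) (by linarith) (by linarith)
    have a1 := next_true n n1
    have a2 := prev_false (n + 1) n2
    have b1 := next_false m k1
    have b2 := prev_true (m + 1) k2
    have d1 := disc_block_succ θ x n
    have d2 := disc_block_succ θ x (n + 1)
    have d3 := disc_block_succ θ x m
    have d4 := disc_block_succ θ x (m + 1)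
    simp only [n1, n2, k1, k2, if_true, Bool.false_eq_true, if_false] at d1 d2 d3 d4
    have r1 := (hx (n + 1)).2
    have r2 := (hx (m + 1)).1
    set r := disc θ (block x 0 (n + 1))
    set s := disc θ (block x 0 (m + 1))
    rw [show disc θ (block x 0 n) = r - 1 + θ by linarith] at a1
    rw [show disc θ (block x 0 m) = s + θ by linarith] at b1
    rw [d2] at a2
    rw [d4] at b2
    have hδ : |K * (r - 1 - s)| ≤ ε := by
      rw [abs_mul, mul_comm]
      refine (mul_le_mul_of_nonneg_right ?_ (abs_nonneg K)).trans m4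
      rw [abs_le]; constructor <;> linarith
    rw [abs_le] at hδ ⊢
    constructor <;> nlinarith [hδ.1, hδ.2]
  have hz : 1 - 2 * θ' - K * (1 - 2 * θ) = 0 := by
    rw [← abs_eq_zero]
    exact le_antisymm (le_of_forall_pos_le_add fun ε hε => by simpa using key ε hε) (abs_nonneg _)
  have hdisc : disc θ' (h (of false) * h (of true)) = (1 : ℤ) - (2 : ℕ) * θ' := by
    rw [disc_mul]
    push_cast
    have : disc θ' (h (of false)) = - K * θ := by rw [hK]; linarith
    have : disc θ' (h (of true)) = K * (1 - θ) := by rw [hK]; linarith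
    linarith
  have hlen := length_eq_of_disc_eq hθ' hdisc
  rw [FreeMonoid.length_mul, hu, hv, FreeMonoid.length_mul, FreeMonoid.length_mul,
    FreeMonoid.length_of, FreeMonoid.length_of] at hlen
  have u0 : u = 1 := FreeMonoid.length_eq_zero.1 (by omega)
  have v0 : v = 1 := FreeMonoid.length_eq_zero.1 (by omega)
  refine end_ext ?_ ?_
  · rw [hu, u0, mul_one]; rfl
  · rw [hv, v0, mul_one]; rfl

/-- If the images of the letters have neither a common first letter `false` nor a common last letter
`false`, and the image of `true` starts with `true`, the morphism is trivial. -/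
lemma ImageInStrip.eq_one_of_first (hi : ImageInStrip h x θ' c') (hx : InStrip x θ c)
    (hθ : Irrational θ) (hθ' : Irrational θ') (hlt : θ' < 1 / 2) (hne : ∀ b, h (of b) ≠ 1)
    {v : FreeMonoid Bool} (hv : h (of true) = of true * v)
    (hlast : ∃ b p, h (of b) = p * of true) : h = 1 := by
  obtain ⟨b, u', hu'⟩ := exists_last (hne false)
  cases b
  case true => exact absurd hv (hi.pair_not_true_true hx hθ hlt false hu')
  obtain ⟨b, v', hv'⟩ := hlast
  cases b
  case false => exact absurd hv (hi.pair_not_true_true hx hθ hlt false hv')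
  obtain ⟨b, u, hu⟩ := exists_first (hne false)
  cases b
  case true => exact absurd hu (hi.pair_not_true_true hx hθ hlt true hv')
  exact hi.eq_one hx hθ hθ' hu hu' hv hv'

end Peeling

/-- The total length of the images of the two letters. -/
def size (h : Monoid.End (FreeMonoid Bool)) : ℕ := (h (of false)).length + (h (of true)).length

lemma nonerasing_of_mul {f g : Monoid.End (FreeMonoid Bool)} (h : ∀ b, (f * g) (of b) ≠ 1)
    (b : Bool) : g (of b) ≠ 1 := fun h0 => h b (by rw [end_mul_apply, h0, map_one])

/-- The step of the induction on `size`, when `true` is the rarer letter of `h(x)`: unless `h` is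
trivial or the exchange, an insertion can be split off on the left. -/
lemma mem_sturmianMonoid_of_lt_half {h : Monoid.End (FreeMonoid Bool)}
    (ih : ∀ g, size g < size h → ∀ x θ c θ' c', Irrational θ → Irrational θ' → InStrip x θ c →
      ImageInStrip g x θ' c' → (∀ b, g (of b) ≠ 1) → g ∈ sturmianMonoid)
    {x : ℕ → Bool} {θ c θ' c' : ℝ} (hθ : Irrational θ) (hθ' : Irrational θ') (hx : InStrip x θ c)
    (hi : ImageInStrip h x θ' c') (hne : ∀ b, h (of b) ≠ 1) (hlt : θ' < 1 / 2) :
    h ∈ sturmianMonoid := by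
  have hθ1 : θ' < 1 := by linarith
  have htt := hi.letter_not_true_true hx hθ hlt
  by_cases hfirst : ∃ b q, h (of b) = of true * q
  · by_cases hlast : ∃ b p, h (of b) = p * of true
    · obtain ⟨b, v, hv⟩ := hfirst
      cases b
      · have e : h * exchange = 1 := by
          refine hi.mul_exchange.eq_one_of_first hx.flip
            (by simpa using hθ.natCast_sub 1) hθ' hlt (v := v) ?_ ?_ ?_
          · intro b; rw [end_mul_apply, exchange_of]; exact hne _
          · rw [end_mul_apply, exchange_of]; exact hv
          · obtain ⟨b, p, hp⟩ := hlast
            exact ⟨!b, p, by rw [end_mul_apply, exchange_of, Bool.not_not, hp]⟩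
        have : h = exchange := by
          rw [← mul_one h, ← exchange_mul_exchange, ← mul_assoc, e, one_mul]
        rw [this]; exact exchange_mem
      · rw [hi.eq_one_of_first hx hθ hθ' hlt hne hv hlast]
        exact one_mem _
    · push Not at hlast
      obtain ⟨u, hu⟩ := exists_insertRight_eq (htt false) (hlast false)
      obtain ⟨v, hv⟩ := exists_insertRight_eq (htt true) (hlast true)
      obtain rfl : h = insertRight * binaryMorphism u v := by
        apply end_ext <;> simp [hu, hv]
      have hg := nonerasing_of_mul hne
      have hi' := hi.of_insertRight_mul hθ1 hg
      refine mul_mem insertRight_mem (ih _ ?_ _ _ _ _ _ hθ (irrational_div_one_sub hθ') hx.tail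
        hi' hg)
      have := hi'.exists_true hx.tail hθ (irrational_div_one_sub hθ') hg
      simp only [size, end_mul_apply, length_insertRight]
      omega
  · push Not at hfirst
    obtain ⟨u, hu⟩ := exists_insertLeft_eq (htt false) (hfirst false)
    obtain ⟨v, hv⟩ := exists_insertLeft_eq (htt true) (hfirst true)
    obtain rfl : h = insertLeft * binaryMorphism u v := by
      apply end_ext <;> simp [hu, hv]
    have hg := nonerasing_of_mul hne
    have hi' := hi.of_insertLeft_mul hθ1 hg
    refine mul_mem insertLeft_mem (ih _ ?_ _ _ _ _ _ hθ (irrational_div_one_sub hθ') hx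
      hi' hg)
    have := hi'.exists_true hx hθ (irrational_div_one_sub hθ') hg
    simp only [size, end_mul_apply, length_insertLeft]
    omega

/-- If `true` is the more frequent letter of `h(x)`, the letters of `h(x)` are exchanged first. -/
lemma ImageInStrip.mem_sturmianMonoid {h : Monoid.End (FreeMonoid Bool)} {x : ℕ → Bool}
    {θ c θ' c' : ℝ} (hi : ImageInStrip h x θ' c') (hx : InStrip x θ c) (hθ : Irrational θ)
    (hθ' : Irrational θ') (hne : ∀ b, h (of b) ≠ 1) : h ∈ sturmianMonoid := by
  induction hs : size h using Nat.strong_induction_on generalizing h x θ c θ' c' with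
  | _ N ih =>
    have ih' : ∀ g, size g < N → ∀ x θ c θ' c', Irrational θ → Irrational θ' → InStrip x θ c →
        ImageInStrip g x θ' c' → (∀ b, g (of b) ≠ 1) → g ∈ sturmianMonoid :=
      fun g hg x θ c θ' c' h1 h2 h3 h4 h5 => ih _ hg h4 h3 h1 h2 h5 rfl
    rcases lt_trichotomy θ' (1 / 2) with hlt | heq | hgt
    · exact mem_sturmianMonoid_of_lt_half (hs ▸ ih') hθ hθ' hx hi hne hlt
    · exact absurd ⟨1 / 2, by rw [heq]; norm_num⟩ hθ'
    · have hlen : ∀ w, (exchange w).length = w.length := fun w => by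
        induction w using FreeMonoid.inductionOn' with
        | one => simp
        | of_mul b w ih => rw [map_mul, FreeMonoid.length_mul, ih, exchange_of]; simp
      have hs' : size (exchange * h) = N := by
        rw [← hs]; simp only [size, end_mul_apply, hlen]
      have : exchange * h ∈ sturmianMonoid := by
        refine mem_sturmianMonoid_of_lt_half (hs' ▸ ih') hθ (by simpa using hθ'.natCast_sub 1) hx
          hi.exchange_mul (fun b h0 => hne b ?_) (by linarith)
        rw [← exchange_exchange (h (of b)), ← end_mul_apply exchange h, h0, map_one]
      have := mul_mem exchange_mem this
      rwa [← mul_assoc, exchange_mul_exchange, one_mul] at this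

/-- A binary morphism that maps one Sturmian word to a Sturmian word is generated by the elementary
ones. -/
theorem IsImage.mem_sturmianMonoid {h : Monoid.End (FreeMonoid Bool)} {x y : ℕ → Bool}
    (hxy : IsImage h x y) (hx : IsMechanical x) (hy : IsMechanical y) : h ∈ sturmianMonoid := by
  rw [isMechanical_iff_inStrip] at hx hy
  obtain ⟨θ, c, hθ, hx⟩ := hx
  obtain ⟨θ', c', hθ', hy⟩ := hy
  have hi := hxy.imageInStrip hy
  refine hi.mem_sturmianMonoid hx hθ hθ' (hi.nonerasing hx hθ hθ' ?_)
  by_contra hcon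
  push Not at hcon
  obtain ⟨n, hn⟩ : ∃ n, 1 ≤ (h (block x 0 n)).length := hxy.2 1
  have h1 : ∀ w, h w = 1 := fun w => by
    induction w using FreeMonoid.inductionOn' with
    | one => exact map_one h
    | of_mul b w ih => rw [map_mul, ih, hcon, one_mul]
  rw [h1] at hn
  simp at hn

/-! ### Properties of the binary Sturmian morphisms -/

section Properties

variable {h : Monoid.End (FreeMonoid Bool)}

/-- Induction along a factorization whose factors are split off on the right. -/
lemma sturmianMonoid_induction {P : Monoid.End (FreeMonoid Bool) → Prop} (h1 : P 1)
    (he : ∀ g, P g → P (g * exchange)) (hl : ∀ g, P g → P (g * insertLeft))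
    (hr : ∀ g, P g → P (g * insertRight)) (hh : h ∈ sturmianMonoid) : P h := by
  induction hh using Submonoid.closure_induction_right with
  | one => exact h1
  | mul_right g hg s hs ih =>
    rcases hs with rfl | rfl | rfl
    · exact he g ih
    · exact hl g ih
    · exact hr g ih

lemma nonerasing_of_mem_sturmianMonoid (hh : h ∈ sturmianMonoid) (b : Bool) : h (of b) ≠ 1 := by
  revert b
  refine sturmianMonoid_induction (P := fun h => ∀ b, h (of b) ≠ 1) ?_ ?_ ?_ ?_ hh
  · intro b; exact FreeMonoid.of_ne_one b
  · intro g hg b; rw [end_mul_apply, exchange_of]; exact hg _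
  all_goals
    intro g hg b
    have h0 := hg false
    rw [Ne, ← FreeMonoid.length_eq_zero] at h0 ⊢
    cases b
    · exact h0
    · simp only [end_mul_apply, insertLeft_true, insertRight_true, map_mul, FreeMonoid.length_mul]
      omega

lemma IsMechanical.exists_image_exchange {x : ℕ → Bool} (hx : IsMechanical x) :
    ∃ y, IsImage exchange x y ∧ IsMechanical y := by
  rw [isMechanical_iff_inStrip] at hx
  obtain ⟨θ, c, hθ, hx⟩ := hx
  refine ⟨fun k => !x k, ⟨fun n => ⟨n, exchange_block x n⟩, fun N => ⟨N, ?_⟩⟩,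
    (isMechanical_iff_inStrip _).2 ⟨1 - θ, _, by simpa using hθ.natCast_sub 1, hx.flip⟩⟩
  exact (length_block _ 0 N).symm.le.trans (congrArg FreeMonoid.length (exchange_block x N)).symm.le

/-- A prefix of the image of a block ends inside the image of one letter. -/
lemma exists_prefix_of_block {f : Monoid.End (FreeMonoid Bool)} {x : ℕ → Bool} (n : ℕ)
    {p q : FreeMonoid Bool} (e : f (block x 0 n) = p * q) :
    ∃ m r s, p = f (block x 0 m) * r ∧ (r = 1 ∨ f (of (x m)) = r * s) := by
  induction n generalizing p q with
  | zero =>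
    refine ⟨0, 1, 1, ?_, Or.inl rfl⟩
    have := congrArg FreeMonoid.length e
    simp only [block_zero, map_one, FreeMonoid.length_one, FreeMonoid.length_mul] at this
    rw [FreeMonoid.length_eq_zero.1 (by omega : p.length = 0)]; simp
  | succ n ih =>
    rw [block_succ, map_mul, zero_add] at e
    have e' := congrArg FreeMonoid.toList e
    rw [FreeMonoid.toList_mul, FreeMonoid.toList_mul, List.append_eq_append_iff] at e'
    rcases e' with ⟨r, h1, h2⟩ | ⟨r, h1, h2⟩
    · exact ⟨n, FreeMonoid.ofList r, q, FreeMonoid.toList.injective (by simpa using h1),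
        Or.inr (FreeMonoid.toList.injective (by simpa using h2))⟩
    · exact ih (q := FreeMonoid.ofList r) (FreeMonoid.toList.injective (by simpa using h1))

lemma eq_of_of_eq_mul {α : Type*} {a : α} {r s : FreeMonoid α} (e : of a = r * s) :
    r = 1 ∨ r = of a := by
  induction r using FreeMonoid.casesOn with
  | one => exact Or.inl rfl
  | of_mul b u =>
    rw [mul_assoc, ← mul_one (of a)] at e
    obtain ⟨e1, e2⟩ := mul_inj_of_length_eq e (by simp)
    have hl := congrArg FreeMonoid.length e2
    rw [FreeMonoid.length_one, FreeMonoid.length_mul] at hl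
    rw [FreeMonoid.length_eq_zero.1 (by omega : u.length = 0), ← e1, mul_one]
    exact Or.inr rfl

lemma eq_of_of_mul_of_eq_mul {α : Type*} {a b : α} {r s : FreeMonoid α}
    (e : of a * of b = r * s) : r = 1 ∨ r = of a ∨ r = of a * of b := by
  induction r using FreeMonoid.casesOn with
  | one => exact Or.inl rfl
  | of_mul c u =>
    rw [mul_assoc] at e
    obtain ⟨e1, e2⟩ := mul_inj_of_length_eq e (by simp)
    rw [← e1]
    rcases eq_of_of_eq_mul e2 with rfl | rfl
    · exact Or.inr (Or.inl (mul_one _))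
    · exact Or.inr (Or.inr rfl)

lemma irrational_div_one_add {θ : ℝ} (h : Irrational θ) : Irrational (θ / (1 + θ)) := by
  have h1 : 1 + θ ≠ 0 := fun h' => h.ne_int (-1) (by push_cast; linarith)
  have h2 : Irrational ((1 + θ)⁻¹) := by simpa using (h.natCast_add 1).inv
  convert h2.natCast_sub 1 using 1
  push_cast
  field_simp
  ring

lemma InStrip.image_insertLeft {x : ℕ → Bool} {θ c : ℝ} (hx : InStrip x θ c) (h0 : 0 < θ) :
    ImageInStrip insertLeft x (θ / (1 + θ)) ((c - θ) / (1 + θ)) := by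
  intro n p q e
  have hp : 0 < 1 + θ := by linarith
  have hθ1 : θ / (1 + θ) ≠ 1 := by rw [Ne, div_eq_one_iff_eq hp.ne']; linarith
  have hθ2 : θ / (1 + θ) / (1 - θ / (1 + θ)) = θ := by field_simp; ring_nf
  have hθ3 : 1 - θ / (1 + θ) = 1 / (1 + θ) := by field_simp; ring
  have hd := fun w => disc_insertLeft hθ1 w
  rw [hθ2, hθ3] at hd
  have full : ∀ m, (c - θ) / (1 + θ) ≤ disc (θ / (1 + θ)) (insertLeft (block x 0 m)) ∧
      disc (θ / (1 + θ)) (insertLeft (block x 0 m)) ≤ (c - θ) / (1 + θ) + 1 := by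
    intro m
    have := hx m
    rw [hd, div_add_one hp.ne', one_div_mul_eq_div, div_le_div_iff_of_pos_right hp,
      div_le_div_iff_of_pos_right hp]
    constructor <;> linarith
  obtain ⟨m, r, s, rfl, hr⟩ := exists_prefix_of_block (f := insertLeft) n e
  have next : ∀ b, x m = b → insertLeft (block x 0 m) * insertLeft (of b) =
      insertLeft (block x 0 (m + 1)) := fun b hb => by
    rw [block_succ, map_mul, zero_add, hb]
  rcases hr with rfl | hr
  · rw [mul_one]; exact full m
  cases hxm : x m
  · rw [hxm, insertLeft_false] at hr
    rcases eq_of_of_eq_mul hr with rfl | rfl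
    · rw [mul_one]; exact full m
    · have := next _ hxm
      rw [insertLeft_false] at this
      rw [this]; exact full _
  · rw [hxm, insertLeft_true] at hr
    rcases eq_of_of_mul_of_eq_mul hr with rfl | rfl | rfl
    · rw [mul_one]; exact full m
    · have h1 := hx m
      have h2 := hx (m + 1)
      rw [disc_block_succ, hxm, if_pos rfl] at h2
      rw [disc_mul, hd, disc_of_false, div_add_one hp.ne', one_div_mul_eq_div,
        ← sub_eq_add_neg, ← sub_div, div_le_div_iff_of_pos_right hp,
        div_le_div_iff_of_pos_right hp]
      constructor <;> linarith
    · have := next _ hxm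
      rw [insertLeft_true] at this
      rw [this]; exact full _

lemma InStrip.image_insertRight {x : ℕ → Bool} {θ c : ℝ} (hx : InStrip x θ c) (h0 : 0 < θ) :
    ImageInStrip insertRight x (θ / (1 + θ)) (c / (1 + θ)) := by
  intro n p q e
  have hp : 0 < 1 + θ := by linarith
  have hθ1 : θ / (1 + θ) ≠ 1 := by rw [Ne, div_eq_one_iff_eq hp.ne']; linarith
  have hθ2 : θ / (1 + θ) / (1 - θ / (1 + θ)) = θ := by field_simp; ring_nf
  have hθ3 : 1 - θ / (1 + θ) = 1 / (1 + θ) := by field_simp; ring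
  have hd := fun w => disc_insertRight hθ1 w
  rw [hθ2, hθ3] at hd
  have full : ∀ m, c / (1 + θ) ≤ disc (θ / (1 + θ)) (insertRight (block x 0 m)) ∧
      disc (θ / (1 + θ)) (insertRight (block x 0 m)) ≤ c / (1 + θ) + 1 := by
    intro m
    have := hx m
    rw [hd, div_add_one hp.ne', one_div_mul_eq_div, div_le_div_iff_of_pos_right hp,
      div_le_div_iff_of_pos_right hp]
    constructor <;> linarith
  obtain ⟨m, r, s, rfl, hr⟩ := exists_prefix_of_block (f := insertRight) n e
  have next : ∀ b, x m = b → insertRight (block x 0 m) * insertRight (of b) =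
      insertRight (block x 0 (m + 1)) := fun b hb => by
    rw [block_succ, map_mul, zero_add, hb]
  rcases hr with rfl | hr
  · rw [mul_one]; exact full m
  cases hxm : x m
  · rw [hxm, insertRight_false] at hr
    rcases eq_of_of_eq_mul hr with rfl | rfl
    · rw [mul_one]; exact full m
    · have := next _ hxm
      rw [insertRight_false] at this
      rw [this]; exact full _
  · rw [hxm, insertRight_true] at hr
    rcases eq_of_of_mul_of_eq_mul hr with rfl | rfl | rfl
    · rw [mul_one]; exact full m
    · have h1 := hx m
      have h2 := hx (m + 1)
      rw [disc_block_succ, hxm, if_pos rfl] at h2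
      rw [disc_mul, hd, disc_of_true, div_add_one hp.ne', one_div_mul_eq_div, hθ3,
        ← add_div, div_le_div_iff_of_pos_right hp, div_le_div_iff_of_pos_right hp]
      constructor <;> linarith
    · have := next _ hxm
      rw [insertRight_true] at this
      rw [this]; exact full _

/-- The morphisms in `sturmianMonoid` map all mechanical words to mechanical words. -/
lemma IsMechanical.exists_image_of_mem {x : ℕ → Bool} (hh : h ∈ sturmianMonoid)
    (hx : IsMechanical x) : ∃ y, IsImage h x y ∧ IsMechanical y := by
  have insert : ∀ f ∈ sturmianMonoid, (∀ x θ c, InStrip x θ c → 0 < θ →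
      ∃ c', ImageInStrip f x (θ / (1 + θ)) c') → ∀ x, IsMechanical x →
      ∃ y, IsImage f x y ∧ IsMechanical y := by
    intro f hf hstrip x hx
    rw [isMechanical_iff_inStrip] at hx
    obtain ⟨θ, c, hθ, hx⟩ := hx
    obtain ⟨c', hc'⟩ := hstrip x θ c hx (hx.slope_mem hθ).1
    obtain ⟨y, hy⟩ := exists_isImage_of_nonerasing (nonerasing_of_mem_sturmianMonoid hf) x
    exact ⟨y, hy, (isMechanical_iff_inStrip y).2 ⟨_, c', irrational_div_one_add hθ,
      hy.inStrip hc'⟩⟩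
  have comp : ∀ f g : Monoid.End (FreeMonoid Bool),
      (∀ x, IsMechanical x → ∃ y, IsImage g x y ∧ IsMechanical y) →
      (∀ x, IsMechanical x → ∃ y, IsImage f x y ∧ IsMechanical y) →
      ∀ x, IsMechanical x → ∃ y, IsImage (g * f : Monoid.End (FreeMonoid Bool)) x y ∧
        IsMechanical y := by
    intro f g hg hf x hx
    obtain ⟨y, hy, hy'⟩ := hf x hx
    obtain ⟨z, hz, hz'⟩ := hg y hy'
    exact ⟨z, hy.comp hz, hz'⟩
  revert x
  have main : ∀ x, IsMechanical x → ∃ y, IsImage h x y ∧ IsMechanical y := by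
    refine sturmianMonoid_induction
      (P := fun h => ∀ x, IsMechanical x → ∃ y, IsImage h x y ∧ IsMechanical y)
      (fun x hx => ⟨x, IsImage.id x, hx⟩) (fun g hg => comp _ g hg ?_) (fun g hg => comp _ g hg ?_)
      (fun g hg => comp _ g hg ?_) hh
    · exact fun x hx => hx.exists_image_exchange
    · exact insert _ insertLeft_mem fun x θ c hx h0 => ⟨_, hx.image_insertLeft h0⟩
    · exact insert _ insertRight_mem fun x θ c hx h0 => ⟨_, hx.image_insertRight h0⟩
  exact fun {x} => main x

/-- The number of occurrences of a letter, as an integer. -/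
def occ {α : Type*} [DecidableEq α] (a : α) (w : FreeMonoid α) : ℤ :=
  (FreeMonoid.toList w).count a

@[simp] lemma occ_mul {α : Type*} [DecidableEq α] (a : α) (u v : FreeMonoid α) :
    occ a (u * v) = occ a u + occ a v := by
  simp [occ]

lemma occ_nonneg {α : Type*} [DecidableEq α] (a : α) (w : FreeMonoid α) : 0 ≤ occ a w :=
  Int.natCast_nonneg _

/-- The determinant of the numbers of letters `false` and `true` in two words. -/
def det (u v : FreeMonoid Bool) : ℤ := occ false u * occ true v - occ true u * occ false v

lemma det_of_mem_sturmianMonoid (hh : h ∈ sturmianMonoid) :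
    det (h (of false)) (h (of true)) = 1 ∨ det (h (of false)) (h (of true)) = -1 := by
  refine sturmianMonoid_induction
    (P := fun h => det (h (of false)) (h (of true)) = 1 ∨ det (h (of false)) (h (of true)) = -1)
    ?_ ?_ ?_ ?_ hh
  · left
    change det (of false) (of true) = 1
    simp [det, occ]
  all_goals
    intro g hg
    simp only [end_mul_apply, exchange_of, insertLeft_false, insertLeft_true, insertRight_false,
      insertRight_true, Bool.not_false, Bool.not_true, map_mul]
    simp only [det, occ_mul] at hg ⊢
  · rcases hg with hg | hg
    · right; linarith
    · left; linarith
  all_goals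
    rcases hg with hg | hg
    · left; linarith
    · right; linarith

/-- One of two words is a prefix or a suffix of the other. -/
def Comparable {α : Type*} (u v : FreeMonoid α) : Prop :=
  ∃ w, u = v * w ∨ u = w * v ∨ v = u * w ∨ v = w * u

lemma Comparable.symm {α : Type*} {u v : FreeMonoid α} (h : Comparable u v) : Comparable v u := by
  obtain ⟨w, hw⟩ := h
  exact ⟨w, by tauto⟩

lemma Comparable.map {α β : Type*} {u v : FreeMonoid α} (h : Comparable u v)
    (f : FreeMonoid α →* FreeMonoid β) : Comparable (f u) (f v) := by
  obtain ⟨w, rfl | rfl | rfl | rfl⟩ := h <;> refine ⟨f w, ?_⟩ <;> simp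

/-- Peeling off the first elementary factor shows that the images of the letters under a binary
Sturmian morphism are comparable unless both are letters. -/
lemma comparable_of_mem_sturmianMonoid (hh : h ∈ sturmianMonoid) :
    (∀ b, (h (of b)).length = 1) ∨ Comparable (h (of false)) (h (of true)) := by
  refine sturmianMonoid_induction
    (P := fun h => (∀ b, (h (of b)).length = 1) ∨ Comparable (h (of false)) (h (of true)))
    ?_ ?_ ?_ ?_ hh
  · left; intro b; exact FreeMonoid.length_of b
  · rintro g (hg | hg)
    · left; intro b; rw [end_mul_apply, exchange_of]; exact hg _
    · right; simpa only [end_mul_apply, exchange_of, Bool.not_false, Bool.not_true] using hg.symm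
  · intro g _
    right
    simp only [end_mul_apply, insertLeft_false, insertLeft_true, map_mul]
    exact ⟨g (of true), by tauto⟩
  · intro g _
    right
    simp only [end_mul_apply, insertRight_false, insertRight_true, map_mul]
    exact ⟨g (of true), by tauto⟩

end Properties

/-! ### Binary coding of the erasures -/

/-- The two letters other than `k`: `k + 1` for `false` and `k + 2` for `true`, modulo `3`. -/
def otherLetter (k : A3) (b : Bool) : A3 := if b then k + 2 else k + 1

/-- The binary coding of `π_k`: erases `k`, and codes `k + 1` and `k + 2` by `false` and `true`. -/
def project (k : A3) : FreeMonoid A3 →* FreeMonoid Bool :=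
  FreeMonoid.lift fun j => if j = k then 1 else of (decide (j = k + 2))

/-- The morphism that replaces `false` and `true` by `k + 1` and `k + 2`. -/
def embed (k : A3) : FreeMonoid Bool →* FreeMonoid A3 := FreeMonoid.map (otherLetter k)

lemma otherLetter_injective (k : A3) : Function.Injective (otherLetter k) := by
  revert k; decide

lemma otherLetter_ne (k : A3) (b : Bool) : otherLetter k b ≠ k := by
  revert k b; decide

lemma eq_or_eq_otherLetter (k j : A3) : j = k ∨ ∃ b, j = otherLetter k b := by
  revert k j; decide

@[simp] lemma project_self (k : A3) : project k (of k) = 1 := by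
  simp [project]

@[simp] lemma project_otherLetter (k : A3) (b : Bool) :
    project k (of (otherLetter k b)) = of b := by
  have h : decide (otherLetter k b = k + 2) = b := by revert k b; decide
  simp [project, otherLetter_ne, h]

lemma erase_self (k : A3) : erase k (of k) = 1 := by
  change FreeMonoid.lift _ _ = _
  simp

lemma erase_of_ne {k j : A3} (h : j ≠ k) : erase k (of j) = of j := by
  change FreeMonoid.lift _ _ = _
  simp [h]

lemma embed_comp_project (k : A3) : (embed k).comp (project k) = erase k := by
  refine FreeMonoid.hom_eq fun j => ?_
  rcases eq_or_eq_otherLetter k j with rfl | ⟨b, rfl⟩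
  · rw [MonoidHom.comp_apply, project_self, map_one]; exact (erase_self j).symm
  · rw [MonoidHom.comp_apply, project_otherLetter]; exact (erase_of_ne (otherLetter_ne k b)).symm

lemma embed_project (k : A3) (w : FreeMonoid A3) : embed k (project k w) = erase k w :=
  DFunLike.congr_fun (embed_comp_project k) w

lemma length_map {α β : Type*} (f : α → β) (w : FreeMonoid α) :
    (FreeMonoid.map f w).length = w.length := by
  simp [FreeMonoid.length, FreeMonoid.toList_map]

lemma length_embed (k : A3) (w : FreeMonoid Bool) : (embed k w).length = w.length :=
  length_map _ w

lemma length_project_le (k : A3) (w : FreeMonoid A3) : (project k w).length ≤ w.length := by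
  induction w using FreeMonoid.inductionOn' with
  | one => simp
  | of_mul j w ih =>
    rw [map_mul, FreeMonoid.length_mul, FreeMonoid.length_mul, FreeMonoid.length_of]
    rcases eq_or_eq_otherLetter k j with rfl | ⟨b, rfl⟩
    · rw [project_self, FreeMonoid.length_one]; omega
    · rw [project_otherLetter, FreeMonoid.length_of]; omega

lemma map_block {α β : Type*} (f : α → β) (x : ℕ → α) (k n : ℕ) :
    FreeMonoid.map f (block x k n) = block (f ∘ x) k n := by
  induction n with
  | zero => simp
  | succ n ih => rw [block_succ, block_succ, map_mul, ih, FreeMonoid.map_of]; rfl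

lemma isImage_map {α β : Type*} (f : α → β) (x : ℕ → α) :
    IsImage (FreeMonoid.map f) x (f ∘ x) :=
  ⟨fun n => ⟨n, map_block f x 0 n⟩, fun N => ⟨N, by rw [map_block, length_block]⟩⟩

lemma isSturmian_comp_iff {α β : Type*} {f : α → β} (hf : Function.Injective f) (x : ℕ → α) :
    IsSturmian (f ∘ x) ↔ IsSturmian x := by
  have hinj : Function.Injective (FreeMonoid.map f) := fun u v h =>
    FreeMonoid.toList.injective (List.map_injective_iff.2 hf (congrArg FreeMonoid.toList h))
  have : ∀ n, complexity (f ∘ x) n = complexity x n := by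
    intro n
    unfold complexity
    rw [← Set.ncard_image_of_injective {w : FreeMonoid α | ∃ k, w = block x k n} hinj]
    congr 1
    ext w; constructor
    · rintro ⟨k, rfl⟩; exact ⟨_, ⟨k, rfl⟩, map_block f x k n⟩
    · rintro ⟨_, ⟨k, rfl⟩, rfl⟩; exact ⟨k, map_block f x k n⟩
  simp only [IsSturmian, this]

/-- Words with Sturmian erasures in terms of the binary codings of their erasures. -/
lemma mem_WSE_iff (x : ℕ → A3) :
    x ∈ WSE ↔ ∀ k, ∃ z, IsImage (project k) x z ∧ IsMechanical z := by
  have himage : ∀ k z, IsImage (project k) x z → IsImage (erase k) x (otherLetter k ∘ z) := by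
    intro k z hz
    have := hz.comp (isImage_map (otherLetter k) z)
    rwa [← embed, embed_comp_project] at this
  constructor
  · intro hx k
    obtain ⟨y, hy, hs⟩ := hx k
    obtain ⟨z, hz⟩ := exists_isImage (project k) x fun N => by
      obtain ⟨n, hn⟩ : ∃ n, N ≤ (erase k (block x 0 n)).length := hy.2 N
      refine ⟨n, ?_⟩
      rwa [← embed_project, length_embed] at hn
    refine ⟨z, hz, ?_⟩
    rw [(himage k z hz).unique hy |>.symm, isSturmian_comp_iff (otherLetter_injective k),
      isSturmian_iff_isMechanical] at hs
    exact hs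
  · intro hx k
    obtain ⟨z, hz, hm⟩ := hx k
    exact ⟨_, himage k z hz,
      (isSturmian_comp_iff (otherLetter_injective k) z).2 ((isSturmian_iff_isMechanical z).2 hm)⟩

/-- The composition of a morphism from binary words with the coded erasure of `k`. -/
def projectComp (k : A3) (g : FreeMonoid Bool →* FreeMonoid A3) : Monoid.End (FreeMonoid Bool) :=
  (project k).comp g

lemma projectComp_apply (k : A3) (g : FreeMonoid Bool →* FreeMonoid A3) (w : FreeMonoid Bool) :
    projectComp k g w = project k (g w) := rfl

lemma projectComp_mem {g : FreeMonoid Bool →* FreeMonoid A3} {u : ℕ → Bool} {y : ℕ → A3}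
    (hu : IsMechanical u) (hy : y ∈ WSE) (hg : IsImage g u y) (k : A3) :
    projectComp k g ∈ sturmianMonoid := by
  obtain ⟨w, hw, hw'⟩ := (mem_WSE_iff y).1 hy k
  exact IsImage.mem_sturmianMonoid (hg.comp hw) hu hw'

lemma exists_image_mem_WSE {g : FreeMonoid Bool →* FreeMonoid A3}
    (hg : ∀ k, projectComp k g ∈ sturmianMonoid) {u : ℕ → Bool} (hu : IsMechanical u) :
    ∃ y ∈ WSE, IsImage g u y := by
  choose w hw hw' using fun k => hu.exists_image_of_mem (hg k)
  obtain ⟨y, hy⟩ := exists_isImage g u fun N => by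
    obtain ⟨n, hn⟩ := (hw 0).2 N
    exact ⟨n, hn.trans (length_project_le 0 _)⟩
  exact ⟨y, (mem_WSE_iff y).2 fun k => ⟨w k, hy.of_comp (hw k), hw' k⟩, hy⟩

/-- The restriction of a morphism to words without the letter `i`, in binary coding. -/
def restrict (f : Morphism) (i : A3) : FreeMonoid Bool →* FreeMonoid A3 :=
  MonoidHom.comp f (embed i)

lemma restrict_comp_project {f : Morphism} {i : A3} (hf : f (of i) = 1) :
    (restrict f i).comp (project i) = f := by
  refine FreeMonoid.hom_eq fun j => ?_
  rw [MonoidHom.comp_apply]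
  rcases eq_or_eq_otherLetter i j with rfl | ⟨b, rfl⟩
  · rw [project_self, map_one]; exact hf.symm
  · rw [project_otherLetter]; rfl

lemma projectComp_restrict_mem {f : Morphism} {i : A3} (hf : f (of i) = 1)
    (h : IsLocallyWSE f) (k : A3) : projectComp k (restrict f i) ∈ sturmianMonoid := by
  obtain ⟨x, hx, y, hy, hxy⟩ := h
  obtain ⟨u, hu, hu'⟩ := (mem_WSE_iff x).1 hx i
  rw [← restrict_comp_project hf] at hxy
  exact projectComp_mem hu' hy (hu.of_comp hxy) k

lemma mem_MSE_of_projectComp_restrict_mem {f : Morphism} {i : A3} (hf : f (of i) = 1)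
    (h : ∀ k, projectComp k (restrict f i) ∈ sturmianMonoid) : f ∈ MSE := by
  intro x hx
  obtain ⟨u, hu, hu'⟩ := (mem_WSE_iff x).1 hx i
  obtain ⟨y, hy, hy'⟩ := exists_image_mem_WSE h hu'
  have := hu.comp hy'
  rw [restrict_comp_project hf] at this
  exact ⟨y, hy, this⟩

/-- A morphism `f` that erases `i` is given by its restriction to the words without `i`, and the
condition that the coded erasures of this restriction are in `sturmianMonoid` does not depend on the
word on which `f` is known to preserve Sturmian erasures. -/
theorem mem_MSE_of_isLocallyWSE {f : Morphism} (h : IsLocallyWSE f) (hf : ErasesLetter f) :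
    f ∈ MSE := by
  obtain ⟨i, hi⟩ := hf
  exact mem_MSE_of_projectComp_restrict_mem hi (projectComp_restrict_mem hi h)

/-! ### Existence of words with Sturmian erasures -/

/-- The words `⌊(n + 1) θ⌋ - ⌊n θ⌋` are mechanical. -/
lemma exists_isMechanical : ∃ u, IsMechanical u := by
  obtain ⟨θ, hθ, h0, h1⟩ := exists_irrational_btwn (show (0 : ℝ) < 1 by norm_num)
  have hstep : ∀ n : ℕ, ⌊((n + 1 : ℕ) : ℝ) * θ⌋ = ⌊(n : ℝ) * θ⌋ ∨
      ⌊((n + 1 : ℕ) : ℝ) * θ⌋ = ⌊(n : ℝ) * θ⌋ + 1 := by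
    intro n
    have a := Int.floor_le ((n : ℝ) * θ)
    have b := Int.lt_floor_add_one ((n : ℝ) * θ)
    have c := Int.floor_le (((n + 1 : ℕ) : ℝ) * θ)
    have d := Int.lt_floor_add_one (((n + 1 : ℕ) : ℝ) * θ)
    push_cast at c d ⊢
    have e1 : (⌊(n : ℝ) * θ⌋ : ℝ) < ⌊((n : ℝ) + 1) * θ⌋ + 1 := by nlinarith
    have e2 : (⌊((n : ℝ) + 1) * θ⌋ : ℝ) < ⌊(n : ℝ) * θ⌋ + 2 := by nlinarith
    have e1' : ⌊(n : ℝ) * θ⌋ < ⌊((n : ℝ) + 1) * θ⌋ + 1 := by exact_mod_cast e1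
    have e2' : ⌊((n : ℝ) + 1) * θ⌋ < ⌊(n : ℝ) * θ⌋ + 2 := by exact_mod_cast e2
    omega
  let u : ℕ → Bool := fun n => decide (⌊((n + 1 : ℕ) : ℝ) * θ⌋ = ⌊(n : ℝ) * θ⌋ + 1)
  have hones : ∀ n : ℕ, ones u n = ⌊(n : ℝ) * θ⌋ := by
    intro n
    induction n with
    | zero => simp
    | succ n ih =>
      rw [ones_succ, ih]
      rcases hstep n with h | h
      · have : u n = false := by simp only [u, h]; simp
        rw [this, h]; simp
      · have : u n = true := by simp only [u, h]; simp
        rw [this, h]; simp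
  refine ⟨u, θ, -1, hθ, fun n => ?_⟩
  rw [hones]
  have a := Int.floor_le ((n : ℝ) * θ)
  have b := Int.lt_floor_add_one ((n : ℝ) * θ)
  constructor <;> linarith

/-- The morphism `false ↦ (q+2) q`, `true ↦ q (q+1)`, which maps binary Sturmian words to words with
Sturmian erasures. -/
def interleave (q : A3) : FreeMonoid Bool →* FreeMonoid A3 :=
  FreeMonoid.lift fun b => if b then of q * of (q + 1) else of (q + 2) * of q

lemma interleave_false (q : A3) : interleave q (of false) = of (q + 2) * of q := by
  simp [interleave]

lemma interleave_true (q : A3) : interleave q (of true) = of q * of (q + 1) := by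
  simp [interleave]

/-- The morphism that inserts a letter `true` to the right of every letter `false`. -/
def insertTrueRight : Monoid.End (FreeMonoid Bool) := binaryMorphism (of false * of true) (of true)

/-- The morphism that inserts a letter `true` to the left of every letter `false`. -/
def insertTrueLeft : Monoid.End (FreeMonoid Bool) := binaryMorphism (of true * of false) (of true)

lemma insertTrueRight_mem : insertTrueRight ∈ sturmianMonoid := by
  have : insertTrueRight = exchange * insertRight * exchange := by
    apply end_ext <;> simp [insertTrueRight]
  rw [this]
  exact mul_mem (mul_mem exchange_mem insertRight_mem) exchange_mem

lemma insertTrueLeft_mem : insertTrueLeft ∈ sturmianMonoid := by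
  have : insertTrueLeft = exchange * insertLeft * exchange := by
    apply end_ext <;> simp [insertTrueLeft]
  rw [this]
  exact mul_mem (mul_mem exchange_mem insertLeft_mem) exchange_mem

lemma project_of (k j : A3) :
    project k (of j) = if j = k then 1 else of (decide (j = k + 2)) := by
  simp [project]

lemma projectComp_interleave_mem (k q : A3) : projectComp k (interleave q) ∈ sturmianMonoid := by
  have h : projectComp k (interleave q) =
      if k = q then exchange else if k = q + 1 then insertTrueRight else insertLeft := by
    apply end_ext <;>
    rw [projectComp_apply] <;>
    simp only [interleave_false, interleave_true, map_mul, project_of] <;>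
    fin_cases k <;> fin_cases q <;>
    simp [insertTrueRight]
  rw [h]
  split_ifs
  · exact exchange_mem
  · exact insertTrueRight_mem
  · exact insertLeft_mem

lemma WSE_nonempty : WSE.Nonempty := by
  obtain ⟨u, hu⟩ := exists_isMechanical
  obtain ⟨y, hy, -⟩ := exists_image_mem_WSE (fun k => projectComp_interleave_mem k 0) hu
  exact ⟨y, hy⟩

lemma isLocallyWSE_of_mem_MSE {f : Morphism} (hf : f ∈ MSE) : IsLocallyWSE f := by
  obtain ⟨x, hx⟩ := WSE_nonempty
  exact ⟨x, hx, hf x hx⟩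

/-! ### Morphisms with Sturmian erasures erase a letter or permute the letters -/

/-- The signs are all equal, or only one of the three numbers is nonzero. -/
lemma minors_cases {d0 d1 d2 : ℤ} (k0 : d1 + d2 - d0 = 1 ∨ d1 + d2 - d0 = -1)
    (k1 : d2 + d0 - d1 = 1 ∨ d2 + d0 - d1 = -1) (k2 : d0 + d1 - d2 = 1 ∨ d0 + d1 - d2 = -1) :
    ((d0 = d1 ∧ d1 = d2) ∨ ((d0 = 1 ∨ d0 = -1) ∧ d1 = 0 ∧ d2 = 0) ∨
      ((d1 = 1 ∨ d1 = -1) ∧ d0 = 0 ∧ d2 = 0) ∨ ((d2 = 1 ∨ d2 = -1) ∧ d0 = 0 ∧ d1 = 0)) ∧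
    (d0 ≠ 0 ∨ d1 ≠ 0 ∨ d2 ≠ 0) := by
  omega

/-- The hypothesis says that the minors `d j` of a nonnegative `2 × 3` matrix satisfy
`d (q + 1) + d (q + 2) - d q = ±1`. All three cannot be equal, since then the columns would add up
to zero; so just one minor is nonzero and the column it leaves out vanishes. -/
lemma exists_zero_column {a b : A3 → ℤ} (ha : ∀ j, 0 ≤ a j) (hb : ∀ j, 0 ≤ b j)
    (h : ∀ q, (a (q + 2) + a q) * (b q + b (q + 1)) - (b (q + 2) + b q) * (a q + a (q + 1)) = 1 ∨
      (a (q + 2) + a q) * (b q + b (q + 1)) - (b (q + 2) + b q) * (a q + a (q + 1)) = -1) :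
    ∃ q, a q = 0 ∧ b q = 0 ∧ (a (q + 1) * b (q + 2) - b (q + 1) * a (q + 2) = 1 ∨
      a (q + 1) * b (q + 2) - b (q + 1) * a (q + 2) = -1) := by
  have h0 := h 0
  have h1 := h 1
  have h2 := h 2
  have e1 : (0 : A3) + 1 = 1 := rfl
  have e2 : (0 : A3) + 2 = 2 := rfl
  have e3 : (1 : A3) + 1 = 2 := rfl
  have e4 : (1 : A3) + 2 = 0 := rfl
  have e5 : (2 : A3) + 1 = 0 := rfl
  have e6 : (2 : A3) + 2 = 1 := rfl
  simp only [e1, e2, e3, e4, e5, e6] at h0 h1 h2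
  -- `d j` is the minor of the two columns other than `j`; the three minors are the coefficients
  -- of a linear relation between the columns.
  obtain ⟨d0, hd0⟩ : ∃ d, d = a 1 * b 2 - b 1 * a 2 := ⟨_, rfl⟩
  obtain ⟨d1, hd1⟩ : ∃ d, d = a 2 * b 0 - b 2 * a 0 := ⟨_, rfl⟩
  obtain ⟨d2, hd2⟩ : ∃ d, d = a 0 * b 1 - b 0 * a 1 := ⟨_, rfl⟩
  have ra : d0 * a 0 + d1 * a 1 + d2 * a 2 = 0 := by rw [hd0, hd1, hd2]; ring
  have rb : d0 * b 0 + d1 * b 1 + d2 * b 2 = 0 := by rw [hd0, hd1, hd2]; ring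
  have k0 : d1 + d2 - d0 = 1 ∨ d1 + d2 - d0 = -1 := by
    convert h0 using 2 <;> rw [hd0, hd1, hd2] <;> ring
  have k1 : d2 + d0 - d1 = 1 ∨ d2 + d0 - d1 = -1 := by
    convert h1 using 2 <;> rw [hd0, hd1, hd2] <;> ring
  have k2 : d0 + d1 - d2 = 1 ∨ d0 + d1 - d2 = -1 := by
    convert h2 using 2 <;> rw [hd0, hd1, hd2] <;> ring
  clear h h0 h1 h2
  obtain ⟨cases, hne⟩ := minors_cases k0 k1 k2
  have a0 := ha 0; have a1 := ha 1; have a2 := ha 2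
  have b0 := hb 0; have b1 := hb 1; have b2 := hb 2
  rcases cases with ⟨q1, q2⟩ | ⟨q, z1, z2⟩ | ⟨q, z1, z2⟩ | ⟨q, z1, z2⟩
  · exfalso
    subst q2; subst q1
    have hd : d0 ≠ 0 := by tauto
    have sa : a 0 + a 1 + a 2 = 0 :=
      (mul_eq_zero.1 (by linarith : d0 * (a 0 + a 1 + a 2) = 0)).resolve_left hd
    have sb : b 0 + b 1 + b 2 = 0 :=
      (mul_eq_zero.1 (by linarith : d0 * (b 0 + b 1 + b 2) = 0)).resolve_left hd
    apply hd
    rw [hd0, show a 1 = 0 by linarith, show b 1 = 0 by linarith]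
    ring
  · refine ⟨0, ?_, ?_, ?_⟩
    · rcases q with rfl | rfl <;> simp only [z1, z2] at ra <;> linarith
    · rcases q with rfl | rfl <;> simp only [z1, z2] at rb <;> linarith
    · simp only [e1, e2]; rwa [hd0] at q
  · refine ⟨1, ?_, ?_, ?_⟩
    · rcases q with rfl | rfl <;> simp only [z1, z2] at ra <;> linarith
    · rcases q with rfl | rfl <;> simp only [z1, z2] at rb <;> linarith
    · simp only [e3, e4]; rwa [hd1] at q
  · refine ⟨2, ?_, ?_, ?_⟩
    · rcases q with rfl | rfl <;> simp only [z1, z2] at ra <;> linarith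
    · rcases q with rfl | rfl <;> simp only [z1, z2] at rb <;> linarith
    · simp only [e5, e6]; rwa [hd2] at q

lemma eq_one_of_occ {w : FreeMonoid Bool} (h0 : occ false w = 0) (h1 : occ true w = 0) : w = 1 := by
  have : w.length = (FreeMonoid.toList w).count false + (FreeMonoid.toList w).count true :=
    (List.count_false_add_count_true _).symm
  unfold occ at h0 h1
  exact FreeMonoid.length_eq_zero.1 (by omega)

lemma exists_eq_pow {k : A3} {w : FreeMonoid A3} (h : project k w = 1) : ∃ m : ℕ, w = of k ^ m := by
  induction w using FreeMonoid.inductionOn' with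
  | one => exact ⟨0, rfl⟩
  | of_mul j w ih =>
    rw [map_mul] at h
    have hl := congrArg FreeMonoid.length h
    rw [FreeMonoid.length_mul, FreeMonoid.length_one] at hl
    obtain ⟨m, rfl⟩ := ih (FreeMonoid.length_eq_zero.1 (by omega))
    rcases eq_or_eq_otherLetter k j with rfl | ⟨b, rfl⟩
    · exact ⟨m + 1, (pow_succ' _ _).symm⟩
    · rw [project_otherLetter, FreeMonoid.length_of] at hl; omega

lemma projectComp_comp_interleave_mem {f : Morphism} (hf : f ∈ MSE) (k q : A3) :
    projectComp k (MonoidHom.comp f (interleave q)) ∈ sturmianMonoid := by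
  obtain ⟨u, hu⟩ := exists_isMechanical
  obtain ⟨x, hx, hux⟩ := exists_image_mem_WSE (fun k => projectComp_interleave_mem k q) hu
  obtain ⟨y, hy, hxy⟩ := hf x hx
  exact projectComp_mem hu hy (hux.comp hxy) k

/-- Cutting the letter `k` out of the images of the letters under `f` gives a `2 × 3` matrix.
Multiplied by the matrices of the morphisms `interleave q`, it has determinant `±1`, which forces
one of its columns to vanish and the others to be unimodular. -/
lemma exists_image_eq_pow {f : Morphism} (hf : f ∈ MSE) (k : A3) : ∃ q, ∃ m : ℕ,
    f (of q) = of k ^ m ∧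
      (det (project k (f (of (q + 1)))) (project k (f (of (q + 2)))) = 1 ∨
        det (project k (f (of (q + 1)))) (project k (f (of (q + 2)))) = -1) := by
  obtain ⟨q, h0, h1, hdet⟩ := exists_zero_column (a := fun j => occ false (project k (f (of j))))
    (b := fun j => occ true (project k (f (of j)))) (fun j => occ_nonneg _ _)
    (fun j => occ_nonneg _ _) (fun q => by
      have := det_of_mem_sturmianMonoid (projectComp_comp_interleave_mem hf k q)
      have e0 : projectComp k (MonoidHom.comp f (interleave q)) (of false) =
          project k (f (of (q + 2))) * project k (f (of q)) := by
        change project k (f (interleave q (of false))) = _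
        rw [interleave_false, map_mul, map_mul]
      have e1 : projectComp k (MonoidHom.comp f (interleave q)) (of true) =
          project k (f (of q)) * project k (f (of (q + 1))) := by
        change project k (f (interleave q (of true))) = _
        rw [interleave_true, map_mul, map_mul]
      rw [e0, e1] at this
      simpa only [det, occ_mul] using this)
  obtain ⟨m, hm⟩ := exists_eq_pow (eq_one_of_occ h0 h1)
  exact ⟨q, m, hm, hdet⟩

lemma occ_pow {α : Type*} [DecidableEq α] (a : α) (w : FreeMonoid α) (m : ℕ) :
    occ a (w ^ m) = m * occ a w := by
  induction m with
  | zero => simp [occ]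
  | succ m ih => rw [pow_succ, occ_mul, ih]; push_cast; ring

/-- For each `k` some letter `q k` has a power of `k` as its image. If `q` is injective, these
powers are the letters `k` themselves by unimodularity; otherwise the common image is empty. -/
lemma mem_letterPermutations_of_not_erasesLetter {f : Morphism} (hf : f ∈ MSE)
    (he : ¬ ErasesLetter f) : f ∈ letterPermutations := by
  choose q m hm hdet using exists_image_eq_pow hf
  have hinj : Function.Injective q := by
    intro k l hkl
    by_contra hne
    refine he ⟨q k, ?_⟩
    have e : (of k : FreeMonoid A3) ^ m k = of l ^ m l := by rw [← hm k, ← hm l, hkl]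
    obtain ⟨b, rfl⟩ := (eq_or_eq_otherLetter k l).resolve_left (Ne.symm hne)
    have e' := congrArg (fun w => (project k w)) e
    simp only [map_pow, project_self, one_pow, project_otherLetter] at e'
    have : m (otherLetter k b) = 0 := by
      by_contra h0
      obtain ⟨d, hd⟩ := Nat.exists_eq_succ_of_ne_zero h0
      rw [hd, pow_succ] at e'
      have := congrArg FreeMonoid.length e'
      rw [FreeMonoid.length_mul, FreeMonoid.length_of, FreeMonoid.length_one] at this
      omega
    rw [hkl, hm, this, pow_zero]
  have hone : ∀ k, m k = 1 := by
    intro k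
    have hne : q k ≠ q (k + 1) := fun h =>
      absurd (hinj h) ((by decide : ∀ k : A3, k ≠ k + 1) k)
    -- The column of `q k` occurs in the unimodular matrix obtained by erasing `k + 1`, and it is a
    -- multiple of `m k`.
    have hdvd : ∀ b, (m k : ℤ) ∣ occ b (project (k + 1) (f (of (q k)))) := by
      intro b
      rw [hm, map_pow, occ_pow]
      exact dvd_mul_right _ _
    have hmem : q k = q (k + 1) + 1 ∨ q k = q (k + 1) + 2 :=
      (by decide : ∀ i j : A3, i ≠ j → i = j + 1 ∨ i = j + 2) _ _ hne
    have : (m k : ℤ) ∣ det (project (k + 1) (f (of (q (k + 1) + 1))))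
        (project (k + 1) (f (of (q (k + 1) + 2)))) := by
      unfold det
      rcases hmem with h | h
      · rw [← h]
        exact dvd_sub (Dvd.dvd.mul_right (hdvd _) _) (Dvd.dvd.mul_right (hdvd _) _)
      · rw [← h]
        exact dvd_sub (Dvd.dvd.mul_left (hdvd _) _) (Dvd.dvd.mul_left (hdvd _) _)
    have h1 : (m k : ℤ) ∣ 1 := by
      rcases hdet (k + 1) with h | h <;> rw [h] at this
      · exact this
      · exact (dvd_neg.1 this)
    have := Int.eq_one_of_dvd_one (Int.natCast_nonneg _) h1
    exact_mod_cast this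
  let σ := (Equiv.ofBijective q (Finite.injective_iff_bijective.1 hinj)).symm
  refine ⟨σ, fun a => ?_⟩
  have ha : q (σ a) = a := (Equiv.ofBijective q _).apply_symm_apply a
  have := hm (σ a)
  rwa [ha, hone, pow_one] at this

lemma letterPermutations_subset : letterPermutations ⊆ MSE := by
  rintro f ⟨σ, hσ⟩
  obtain rfl : f = FreeMonoid.map σ :=
    FreeMonoid.hom_eq fun a => (hσ a).trans (FreeMonoid.map_of _ _).symm
  intro x hx
  refine ⟨σ ∘ x, fun k => ?_, isImage_map σ x⟩
  obtain ⟨y, hy, hs⟩ := hx (σ.symm k)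
  refine ⟨σ ∘ y, (isImage_map σ x).of_comp ?_, (isSturmian_comp_iff σ.injective y).2 hs⟩
  have e : MonoidHom.comp (erase k) (FreeMonoid.map σ) =
      (FreeMonoid.map σ).comp (erase (σ.symm k)) := by
    refine FreeMonoid.hom_eq fun j => ?_
    change erase k (of (σ j)) = FreeMonoid.map σ (erase (σ.symm k) (of j))
    by_cases h : j = σ.symm k
    · rw [h, erase_self, σ.apply_symm_apply, erase_self, map_one]
    · rw [erase_of_ne h, erase_of_ne fun h' => h (by rw [← h', σ.symm_apply_apply]),
        FreeMonoid.map_of]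
  have := hy.comp (isImage_map σ y)
  rwa [← e] at this

theorem MSE_eq_union : (MSE : Set Morphism) = MSEε ∪ letterPermutations := by
  ext f; constructor
  · intro hf
    by_cases he : ErasesLetter f
    · exact Or.inl ⟨hf, he⟩
    · exact Or.inr (mem_letterPermutations_of_not_erasesLetter hf he)
  · rintro (hf | hf)
    · exact hf.1
    · exact letterPermutations_subset hf

/-! ### The monoid is not finitely generated -/

/-- The morphisms `0 ↦ (12)ⁿ 01`, `1 ↦ 21`, `2 ↦ ε`. -/
def family (n : ℕ) : Morphism :=
  FreeMonoid.lift ![(of 1 * of 2) ^ n * (of 0 * of 1), of 2 * of 1, 1]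

lemma family_zero (n : ℕ) : family n (of 0) = (of 1 * of 2) ^ n * (of 0 * of 1) :=
  FreeMonoid.lift_eval_of _ _

lemma family_one (n : ℕ) : family n (of 1) = of 2 * of 1 := FreeMonoid.lift_eval_of _ _

lemma family_two (n : ℕ) : family n (of 2) = 1 := FreeMonoid.lift_eval_of _ _

lemma binaryMorphism_mul (u v : FreeMonoid Bool) (g : Monoid.End (FreeMonoid Bool)) :
    g * binaryMorphism u v = binaryMorphism (g u) (g v) := by
  apply end_ext <;> simp

lemma family_project_zero_mem (n : ℕ) :
    binaryMorphism ((of false * of true) ^ n * of false) (of true * of false) ∈ sturmianMonoid := by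
  induction n with
  | zero => rw [pow_zero, one_mul]; exact insertRight_mem
  | succ n ih =>
    have := mul_mem ih insertTrueRight_mem
    rw [insertTrueRight, binaryMorphism_mul, map_mul, binaryMorphism_false, binaryMorphism_true]
      at this
    rw [pow_succ]
    simpa only [mul_assoc] using this

lemma family_project_one_mem (n : ℕ) :
    binaryMorphism (of false ^ n * of true) (of false) ∈ sturmianMonoid := by
  induction n with
  | zero => rw [pow_zero, one_mul]; exact exchange_mem
  | succ n ih =>
    have := mul_mem ih insertTrueLeft_mem
    rw [insertTrueLeft, binaryMorphism_mul, map_mul, binaryMorphism_false, binaryMorphism_true]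
      at this
    rw [pow_succ', mul_assoc]
    exact this

lemma family_project_two_mem (n : ℕ) :
    binaryMorphism (of true ^ n * (of false * of true)) (of true) ∈ sturmianMonoid := by
  induction n with
  | zero => rw [pow_zero, one_mul]; exact insertTrueRight_mem
  | succ n ih =>
    have := mul_mem ih insertTrueLeft_mem
    rw [insertTrueLeft, binaryMorphism_mul, map_mul, binaryMorphism_false, binaryMorphism_true]
      at this
    rw [pow_succ', mul_assoc]
    exact this

lemma family_mem_MSE (n : ℕ) : family n ∈ MSE := by
  refine mem_MSE_of_projectComp_restrict_mem (family_two n) fun k => ?_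
  have h0 : projectComp k (restrict (family n) 2) (of false) = project k (family n (of 0)) := rfl
  have h1 : projectComp k (restrict (family n) 2) (of true) = project k (family n (of 1)) := rfl
  rw [family_zero, map_mul, map_pow] at h0
  rw [family_one] at h1
  simp only [map_mul, project_of] at h0 h1
  have key : ∀ u v, projectComp k (restrict (family n) 2) (of false) = u →
      projectComp k (restrict (family n) 2) (of true) = v → binaryMorphism u v ∈ sturmianMonoid →
      projectComp k (restrict (family n) 2) ∈ sturmianMonoid := by
    rintro u v rfl rfl h
    convert h using 1
    apply end_ext <;> simp
  fin_cases k
  · exact key _ _ (h0.trans (by simp)) (h1.trans (by simp)) (family_project_zero_mem n)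
  · exact key _ _ (h0.trans (by simp)) (h1.trans (by simp)) (family_project_one_mem n)
  · exact key _ _ (h0.trans (by simp)) (h1.trans (by simp)) (family_project_two_mem n)

lemma length_family_zero (n : ℕ) : (family n (of 0)).length = 2 * n + 2 := by
  rw [family_zero, FreeMonoid.length_mul, FreeMonoid.length_mul]
  have : ((of 1 * of 2 : FreeMonoid A3) ^ n).length = 2 * n := by
    induction n with
    | zero => rfl
    | succ n ih => rw [pow_succ, FreeMonoid.length_mul, ih]; simp; ring
  rw [this]; rfl

/-- The image of `0` starts with `1` or is `01`, and it ends with `01`, whereas the image of `1`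
is `21`. -/
lemma family_not_comparable (n : ℕ) : ¬ Comparable (family n (of 0)) (family n (of 1)) := by
  have hl := length_family_zero n
  have hprefix : ∀ w, family n (of 0) ≠ of 2 * of 1 * w := by
    intro w h
    rw [family_zero] at h
    rcases n with _ | n
    · rw [pow_zero, one_mul, mul_assoc] at h
      have := (mul_inj_of_length_eq h rfl).1
      exact absurd (FreeMonoid.of_injective this) (by decide)
    · rw [pow_succ', mul_assoc, mul_assoc, mul_assoc] at h
      have := (mul_inj_of_length_eq h rfl).1
      exact absurd (FreeMonoid.of_injective this) (by decide)
  have hsuffix : ∀ w, family n (of 0) ≠ w * (of 2 * of 1) := by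
    intro w h
    have hl' := congrArg FreeMonoid.length h
    rw [family_zero] at h hl'
    simp only [FreeMonoid.length_mul, FreeMonoid.length_of] at hl'
    have h1 := (mul_inj_of_length_eq h (by omega)).2
    exact absurd (FreeMonoid.of_injective (mul_inj_of_length_eq h1 rfl).1) (by decide)
  rintro ⟨w, h⟩
  rw [family_one] at h
  have hw : ∀ v : FreeMonoid A3, of 2 * of 1 = family n (of 0) * v ∨
      of 2 * of 1 = v * family n (of 0) → v = 1 := by
    intro v h
    refine FreeMonoid.length_eq_zero.1 ?_
    rcases h with h | h <;>
    · have := congrArg FreeMonoid.length h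
      rw [FreeMonoid.length_mul, FreeMonoid.length_mul, hl, FreeMonoid.length_of,
        FreeMonoid.length_of] at this
      omega
  rcases h with h | h | h | h
  · exact hprefix w h
  · exact hsuffix w h
  · rw [hw w (Or.inl h), mul_one] at h
    exact hprefix 1 (by rw [mul_one, h])
  · rw [hw w (Or.inr h), one_mul] at h
    exact hprefix 1 (by rw [mul_one, h])

lemma family_injective : Function.Injective family := by
  intro m n h
  have := congrArg (fun f : Morphism => (f (of 0)).length) h
  simp only [length_family_zero] at this
  omega

/-- The morphisms that map every letter to a letter or to the empty word. -/
def shortMorphisms : Set Morphism := {f | ∀ a, (f (of a)).length ≤ 1}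

lemma finite_shortMorphisms : shortMorphisms.Finite := by
  have hfin : (Set.pi Set.univ fun _ : A3 => {w : FreeMonoid A3 | w.length ≤ 1}).Finite :=
    Set.Finite.pi fun _ => List.finite_length_le A3 1
  refine Set.Finite.of_injOn (f := fun (f : Morphism) a => f (of a)) 
    (t := Set.pi Set.univ fun _ : A3 => {w : FreeMonoid A3 | w.length ≤ 1}) (fun f hf a _ => hf a)
    (fun f _ g _ h => FreeMonoid.hom_eq fun a => congrFun h a) hfin

lemma letterPermutations_subset_shortMorphisms : letterPermutations ⊆ shortMorphisms := by
  rintro f ⟨σ, hσ⟩ a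
  rw [hσ, FreeMonoid.length_of]

lemma mul_mem_letterPermutations {f g : Morphism} (hf : f ∈ letterPermutations)
    (hg : g ∈ letterPermutations) : f * g ∈ letterPermutations := by
  obtain ⟨σ, hσ⟩ := hf
  obtain ⟨τ, hτ⟩ := hg
  exact ⟨σ * τ, fun a => by rw [end_mul_apply, hτ, hσ]; rfl⟩

/-- A product of generators is a permutation, or can be cut after its first factor that erases a
letter. -/
lemma factorization_of_mem_closure {S : Set Morphism} (hS : S ⊆ MSE) {f : Morphism}
    (hf : f ∈ Submonoid.closure S) : f ∈ letterPermutations ∨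
      ∃ σ ∈ letterPermutations, ∃ s ∈ S, ErasesLetter s ∧ ∃ g ∈ MSE, f = σ * (s * g) := by
  have h1 : (1 : Morphism) ∈ letterPermutations := ⟨1, fun a => rfl⟩
  induction hf using Submonoid.closure_induction_left with
  | one => exact Or.inl h1
  | mul_left s hs g hg ih =>
    have hsM : s ∈ (MSE : Set Morphism) := hS hs
    rw [MSE_eq_union] at hsM
    rcases hsM with hsM | hsM
    · exact Or.inr ⟨1, h1, s, hs, hsM.2, g, (Submonoid.closure_le.2 hS) hg, by rw [one_mul]⟩
    · rcases ih with ih | ⟨σ, hσ, t, ht, hte, k, hk, rfl⟩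
      · exact Or.inl (mul_mem_letterPermutations hsM ih)
      · exact Or.inr ⟨s * σ, mul_mem_letterPermutations hsM hσ, t, ht, hte, k, hk,
          by rw [mul_assoc]⟩

/-- If `s` erases the letter `i`, then the factor `g` of `σ s g` matters only up to `π_i`. If `g` is
no permutation, it erases `2` and `π_i g` is given by a binary Sturmian morphism; unless that maps
letters to letters, it makes the images of `0` and `1` comparable. -/
lemma exists_shortMorphism {σ s g : Morphism} (hs : ErasesLetter s) (hg : g ∈ MSE)
    (hc : ¬ Comparable ((σ * (s * g)) (of 0)) ((σ * (s * g)) (of 1))) :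
    ∃ t ∈ shortMorphisms, σ * (s * g) = σ * (s * t) := by
  obtain ⟨i, hi⟩ := hs
  have hse : s * erase i = s := by
    have := restrict_comp_project hi
    refine FreeMonoid.hom_eq fun j => ?_
    change s (erase i (of j)) = _
    rw [← embed_project]
    exact DFunLike.congr_fun this (of j)
  refine ⟨erase i * g, fun a => ?_, by rw [← mul_assoc s, hse]⟩
  rw [end_mul_apply, ← embed_project, length_embed]
  have hgM : g ∈ (MSE : Set Morphism) := hg
  rw [MSE_eq_union] at hgM
  rcases hgM with ⟨-, j, hj⟩ | hgp
  · have hj1 : (σ * (s * g)) (of j) = 1 := by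
      rw [end_mul_apply, end_mul_apply, hj, map_one, map_one]
    have hj2 : j = 2 := by
      by_contra hne
      have : j = 0 ∨ j = 1 := (by decide : ∀ j : A3, j ≠ 2 → j = 0 ∨ j = 1) j hne
      rcases this with rfl | rfl
      · exact hc (by rw [hj1]; exact ⟨_, Or.inr (Or.inr (Or.inl (one_mul _).symm))⟩)
      · exact hc (by rw [hj1]; exact ⟨_, Or.inl (one_mul _).symm⟩)
    subst hj2
    rcases comparable_of_mem_sturmianMonoid
      (projectComp_restrict_mem hj (isLocallyWSE_of_mem_MSE hg) i) with h | h
    · rcases eq_or_eq_otherLetter 2 a with rfl | ⟨b, rfl⟩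
      · rw [hj, map_one]; exact Nat.zero_le _
      · exact (h b).le
    · exfalso
      apply hc
      have e : ∀ b, (σ * (s * g)) (of (otherLetter 2 b)) =
          (MonoidHom.comp σ (MonoidHom.comp s (embed i)))
            (projectComp i (restrict g 2) (of b)) := by
        intro b
        change σ (s (g _)) = σ (s (embed i (project i (g _))))
        rw [embed_project, ← end_mul_apply s (erase i), hse]
        rfl
      have := h.map (MonoidHom.comp σ (MonoidHom.comp s (embed i)))
      rw [← e, ← e] at this
      exact this
  · exact (length_project_le i _).trans (letterPermutations_subset_shortMorphisms hgp a)

open scoped Pointwise in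
/-- Each `family n` is a product `σ s t` with `s` one of the generators and `σ` and `t` in the
finite set of short morphisms, so that finitely many generators give finitely many such products. -/
theorem not_fg_MSE : ¬ MSE.FG := by
  rintro ⟨S, hS⟩
  have hSM : (S : Set Morphism) ⊆ MSE := by
    rw [← hS]; exact Submonoid.subset_closure
  have hfin : (shortMorphisms * ((S : Set Morphism) * shortMorphisms)).Finite :=
    finite_shortMorphisms.mul (S.finite_toSet.mul finite_shortMorphisms)
  refine Set.infinite_range_of_injective family_injective (hfin.subset ?_)
  rintro _ ⟨n, rfl⟩
  have hc := family_not_comparable n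
  have h2 := family_two n
  have hmem : family n ∈ Submonoid.closure (S : Set Morphism) := by
    rw [hS]; exact family_mem_MSE n
  rcases factorization_of_mem_closure hSM hmem with ⟨τ, hτ⟩ | ⟨σ, hσ, s, hs, hse, g, hg, e⟩
  · rw [hτ] at h2
    exact absurd h2 (FreeMonoid.of_ne_one _)
  · rw [e] at hc h2
    obtain ⟨t, ht, e'⟩ := exists_shortMorphism hse hg hc
    rw [e, e']
    exact Set.mul_mem_mul (letterPermutations_subset_shortMorphisms hσ) (Set.mul_mem_mul hs ht)

end SturmianErasures

theorem theorem1 :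
    (¬ SturmianErasures.MSE.FG) ∧
    ((SturmianErasures.MSE : Set SturmianErasures.Morphism) =
      SturmianErasures.MSEε ∪ SturmianErasures.letterPermutations) ∧
    (∀ f : SturmianErasures.Morphism, SturmianErasures.IsLocallyWSE f →
      SturmianErasures.ErasesLetter f → f ∈ SturmianErasures.MSE) :=
  ⟨SturmianErasures.not_fg_MSE, SturmianErasures.MSE_eq_union,
    fun _ h hf => SturmianErasures.mem_MSE_of_isLocallyWSE h hf⟩
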